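/- Let $\gamma_1,\gamma_2,\gamma_3>0$, let $\Gamma=\operatorname{diag}(\gamma_1,\gamma_1,\gamma_1+\gamma_2+\gamma_3)$, and let $\langle A,B\rangle=\operatorname{Re}\operatorname{Tr}(A^*B)$ on $\mathfrak{gl}(3,\mathbb C)$. For $v\in\mathbb R^3$ let $\hat v\in\mathfrak{so}(3)$ be the matrix with $\hat v x=v\times x$. Let $S=(SO(3)\times SO(3))\ltimes\mathfrak{gl}(3,\mathbb C)$ be the semidirect product for the representation $(R_1,R_2)\cdot A=R_1AR_2^{-1}$. Write the elements of its Lie algebra $\mathfrak s$ as triples $(v,w,V)\in\mathbb R^3\times\mathbb R^3\times\mathfrak{gl}(3,\mathbb C)$, where $(v,w)$ acts on $\mathfrak{gl}(3,\mathbb C)$ by $A\mapsto\hat vA+A\hat w$, and identify $\mathfrak s^*$ with triples $(\mathbf m,\mathbf n,A)\in\mathbb R^3\times\mathbb R^3\times\mathfrak{gl}(3,\mathbb C)$ through the pairing $\mathbf m\cdot v+\mathbf n\cdot w+\langle A,V\rangle$. On $\mathfrak s^*$ consider the Lie–Poisson bracket $$\{f,g\}=\mathbf m\cdot\Big(\tfrac{\delta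 f}{\delta\mathbf m}\times\tfrac{\delta g}{\delta\mathbf m}\Big)-\mathbf n\cdot\Big(\tfrac{\delta f}{\delta\mathbf n}\times\tfrac{\delta g}{\delta\mathbf n}\Big)+\Big\langle\tfrac{\delta f}{\delta A},\widehat{\tfrac{\delta g}{\delta\mathbf m}}A+A\widehat{\tfrac{\delta g}{\delta\mathbf n}}\Big\rangle-\Big\langle\tfrac{\delta g}{\delta A},\widehat{\tfrac{\delta f}{\delta\mathbf m}}A+A\widehat{\tfrac{\delta f}{\delta\mathbf n}}\Big\rangle ,$$ which restricts to the Poisson bracket of the orbit symplectic form on every coadjoint orbit. Let $A_0\in\mathfrak{gl}(3,\mathbb C)$ be the matrix with rows $(0,0,0),(0,0,0),(1,i,0)$. For $\mathbf m_0,\mathbf n_0\in\mathbb R^3$ let $\mathcal O_{(\mathbf m_0,\mathbf n_0,A_0)}\subset\mathfrak s^*$ be the coadjoint orbit of $S$ through $(\mathbf m_0,\mathbf n_0,A_0)$. Put $\alpha=\hat{\mathbf m}A+A\hat{\mathbf n}$ and $$h=\tfrac14\langle\alpha\,\Gamma^{-1},\alpha\rangle,\qquad j_m=2\langle(\partial_zA)\Gamma,iA\rangle\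 \text{ with }\ \partial_zA:=\tfrac12\,\alpha\,\Gamma^{-1},$$ $$\mathbf J_3^{\mathrm{orb}}=-\mathbf e_3\cdot\mathbf n,\qquad \mathbf J_3^{\mathrm{spin}}=\mathbf e_3\cdot\mathbf m,\qquad \|\mathbf J^{\mathrm{spin}}\|^2=\|\mathbf m\|^2 .$$ **Theorem 4.5.** For all $\gamma_1,\gamma_2,\gamma_3>0$ and all $\mathbf m_0,\mathbf n_0\in\mathbb R^3$, the five smooth functions $h,\ j_m,\ \mathbf J_3^{\mathrm{orb}},\ \mathbf J_3^{\mathrm{spin}},\ \|\mathbf J^{\mathrm{spin}}\|^2$ form a completely integrable system on the coadjoint orbit $\mathcal O_{(\mathbf m_0,\mathbf n_0,A_0)}$. That is, the orbit has dimension ten, any two of the five functions Poisson-commute at every point of the orbit, and the differentials of their restrictions to the orbit are linearly independent at all points of the orbit outside a subset of measure zero. -/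

import Mathlib

open MeasureTheory
open scoped Matrix ContDiff

namespace SuperfluidHe3

noncomputable section

/-! ### The semidirect product `(SO(3) × SO(3)) ⋉ gl(3, ℂ)` and its Lie algebra -/

/-- The rotation group `SO(3)`. -/
abbrev SO3 : Type := Matrix.specialOrthogonalGroup (Fin 3) ℝ

/-- The real vector space `gl(3, ℂ)` (of real dimension 18). -/
abbrev Mat3 : Type := Matrix (Fin 3) (Fin 3) ℂ

/-- A real matrix regarded as a complex one. -/
def cplx (R : Matrix (Fin 3) (Fin 3) ℝ) : Mat3 := R.map Complex.ofReal

/-- The hat map `ℝ³ → so(3)`: `hat v *ᵥ x = v × x`. -/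
def hat (v : Fin 3 → ℝ) : Mat3 :=
  cplx !![0, -v 2, v 1; v 2, 0, -v 0; -v 1, v 0, 0]

/-- The pairing `⟨A, B⟩ = Re Tr (A* B)`, which identifies `gl(3, ℂ)` with its real dual. -/
def ip (A B : Mat3) : ℝ := (Aᴴ * B).trace.re

/-- The representation `(R₁, R₂) · A = R₁ A R₂⁻¹` of `SO(3) × SO(3)` on `gl(3, ℂ)`. It is
orthogonal for `ip`, so that the same formula gives the contragredient representation. -/
def act (g : SO3 × SO3) (A : Mat3) : Mat3 :=
  cplx (g.1 : Matrix (Fin 3) (Fin 3) ℝ) * A * cplx ((g.2⁻¹ : SO3) : Matrix (Fin 3) (Fin 3) ℝ)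

theorem cplx_mul (R S : Matrix (Fin 3) (Fin 3) ℝ) : cplx (R * S) = cplx R * cplx S :=
  Matrix.map_mul (f := Complex.ofRealHom)

theorem act_one (A : Mat3) : act 1 A = A := by
  have h : cplx 1 = 1 := Matrix.map_one _ Complex.ofReal_zero Complex.ofReal_one
  simp [act, h]

theorem act_mul (g h : SO3 × SO3) (A : Mat3) : act (g * h) A = act g (act h A) := by
  simp only [act, Prod.fst_mul, Prod.snd_mul, mul_inv_rev, Submonoid.coe_mul, cplx_mul,
    Matrix.mul_assoc]

theorem act_add (g : SO3 × SO3) (A B : Mat3) : act g (A + B) = act g A + act g B := by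
  simp only [act, Matrix.mul_add, Matrix.add_mul]

/-- The representation `act` as a homomorphism into the automorphisms of the additive group
`gl(3, ℂ)`, written multiplicatively. -/
def rep : SO3 × SO3 →* MulAut (Multiplicative Mat3) where
  toFun g := AddEquiv.toMultiplicative
    { toFun := act g
      invFun := act g⁻¹
      left_inv := fun A => by rw [← act_mul, inv_mul_cancel, act_one]
      right_inv := fun A => by rw [← act_mul, mul_inv_cancel, act_one]
      map_add' := act_add g }
  map_one' := by
    ext A : 1
    exact congrArg Multiplicative.ofAdd (act_one A.toAdd)
  map_mul' g h := by
    ext A : 1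
    exact congrArg Multiplicative.ofAdd (act_mul g h A.toAdd)

/-- The semidirect product group `S = (SO(3) × SO(3)) ⋉ gl(3, ℂ)`. -/
abbrev Grp : Type := Multiplicative Mat3 ⋊[rep] (SO3 × SO3)

/-- The Lie algebra `𝔰 = (so(3) × so(3)) ⋉ gl(3, ℂ)`. The triple `(v, w, V)` stands for
`(hat v, - hat w, V)`: with this choice of sign in the second factor the infinitesimal action
on `gl(3, ℂ)` is `A ↦ hat v * A + A * hat w`. -/
abbrev LieAlg : Type := (Fin 3 → ℝ) × (Fin 3 → ℝ) × Mat3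

/-- The dual `𝔰*`, with points `(m, n, A)`, identified with triples by `pair`. The matrix `A` is
stored as the array of its entries, so that `𝔰*` carries the usual product norm and topology. -/
abbrev LieDual : Type := (Fin 3 → ℝ) × (Fin 3 → ℝ) × (Fin 3 → Fin 3 → ℂ)

/-- The component `A` of a point `(m, n, A)` of `𝔰*`, as a matrix. -/
def mat (p : LieDual) : Mat3 := Matrix.of p.2.2

/-- The duality pairing between `𝔰*` and `𝔰`. -/
def pair (p : LieDual) (ζ : LieAlg) : ℝ :=
  p.1 ⬝ᵥ ζ.1 + p.2.1 ⬝ᵥ ζ.2.1 + ip (mat p) ζ.2.2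

/-- The infinitesimal action `A ↦ hat v * A + A * hat w` of `(v, w)` on `gl(3, ℂ)`. -/
def infAct (v w : Fin 3 → ℝ) (A : Mat3) : Mat3 := hat v * A + A * hat w

/-- The Lie bracket of `𝔰`. -/
def lieBr (ζ η : LieAlg) : LieAlg :=
  (ζ.1 ⨯₃ η.1, -(ζ.2.1 ⨯₃ η.2.1), infAct ζ.1 ζ.2.1 η.2.2 - infAct η.1 η.2.1 ζ.2.2)

/-- The adjoint action `Ad_(g,V) (ξ, U) = (Ad_g ξ, g · U - (Ad_g ξ) · V)` of `S` on `𝔰`. -/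
def Ad (s : Grp) (ζ : LieAlg) : LieAlg :=
  let v := (s.right.1 : Matrix (Fin 3) (Fin 3) ℝ) *ᵥ ζ.1
  let w := (s.right.2 : Matrix (Fin 3) (Fin 3) ℝ) *ᵥ ζ.2.1
  (v, w, act s.right ζ.2.2 - infAct v w s.left.toAdd)

/-! ### Coadjoint orbits and complete integrability -/

/-- The coadjoint orbit through `p₀`: the set of all `Ad*_{s⁻¹} p₀` with `s ∈ S`. -/
def coadjointOrbit (p₀ : LieDual) : Set LieDual :=
  {p | ∃ s : Grp, ∀ ζ : LieAlg, pair p ζ = pair p₀ (Ad s⁻¹ ζ)}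

theorem ip_add_left (A B C : Mat3) : ip (A + B) C = ip A C + ip B C := by
  simp [ip, Matrix.conjTranspose_add, Matrix.add_mul, Matrix.trace_add]

theorem ip_add_right (A B C : Mat3) : ip A (B + C) = ip A B + ip A C := by
  simp [ip, Matrix.mul_add, Matrix.trace_add]

theorem ip_smul_left (c : ℝ) (A B : Mat3) : ip (c • A) B = c * ip A B := by
  simp [ip, Matrix.conjTranspose_smul, Matrix.trace_smul]

theorem ip_smul_right (c : ℝ) (A B : Mat3) : ip A (c • B) = c * ip A B := by
  simp [ip, Matrix.trace_smul]

theorem mat_add (p q : LieDual) : mat (p + q) = mat p + mat q := rfl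

theorem mat_smul (c : ℝ) (p : LieDual) : mat (c • p) = c • mat p := rfl

theorem pair_add_left (p q : LieDual) (ζ : LieAlg) : pair (p + q) ζ = pair p ζ + pair q ζ := by
  simp only [pair, mat_add, Prod.fst_add, Prod.snd_add, add_dotProduct, ip_add_left]; ring

theorem pair_smul_left (c : ℝ) (p : LieDual) (ζ : LieAlg) :
    pair (c • p) ζ = c * pair p ζ := by
  simp only [pair, mat_smul, Prod.smul_fst, Prod.smul_snd, smul_dotProduct, ip_smul_left,
    smul_eq_mul]; ring

theorem pair_add_right (p : LieDual) (ζ η : LieAlg) : pair p (ζ + η) = pair p ζ + pair p η := by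
  simp only [pair, Prod.fst_add, Prod.snd_add, dotProduct_add, ip_add_right]; ring

theorem pair_smul_right (c : ℝ) (p : LieDual) (ζ : LieAlg) :
    pair p (c • ζ) = c * pair p ζ := by
  simp only [pair, Prod.smul_fst, Prod.smul_snd, dotProduct_smul, ip_smul_right, smul_eq_mul]; ring

theorem infAct_add (v w v' w' : Fin 3 → ℝ) (A : Mat3) :
    infAct (v + v') (w + w') A = infAct v w A + infAct v' w' A := by
  have h : ∀ a b : Fin 3 → ℝ, hat (a + b) = hat a + hat b := by
    intro a b
    ext i j
    fin_cases i <;> fin_cases j <;> simp [hat, cplx] <;> ring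
  simp only [infAct, h, Matrix.add_mul, Matrix.mul_add]; abel

theorem infAct_smul (c : ℝ) (v w : Fin 3 → ℝ) (A : Mat3) :
    infAct (c • v) (c • w) A = c • infAct v w A := by
  have h : ∀ a : Fin 3 → ℝ, hat (c • a) = c • hat a := by
    intro a
    ext i j
    fin_cases i <;> fin_cases j <;> simp [hat, cplx]
  simp only [infAct, h, Matrix.smul_mul, Matrix.mul_smul, smul_add]

theorem infAct_add_right (v w : Fin 3 → ℝ) (A B : Mat3) :
    infAct v w (A + B) = infAct v w A + infAct v w B := by
  simp only [infAct, Matrix.add_mul, Matrix.mul_add]; abel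

theorem infAct_smul_right (c : ℝ) (v w : Fin 3 → ℝ) (A : Mat3) :
    infAct v w (c • A) = c • infAct v w A := by
  simp only [infAct, Matrix.smul_mul, Matrix.mul_smul, smul_add]

theorem lieBr_add_left (ζ ζ' η : LieAlg) : lieBr (ζ + ζ') η = lieBr ζ η + lieBr ζ' η := by
  simp only [lieBr, Prod.fst_add, Prod.snd_add, infAct_add, infAct_add_right, map_add,
    LinearMap.add_apply, Prod.mk_add_mk]
  refine Prod.ext rfl (Prod.ext ?_ ?_)
  · simp only; abel
  · simp only; abel

theorem lieBr_smul_left (c : ℝ) (ζ η : LieAlg) : lieBr (c • ζ) η = c • lieBr ζ η := by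
  simp only [lieBr, Prod.smul_fst, Prod.smul_snd, infAct_smul, infAct_smul_right, map_smul,
    LinearMap.smul_apply, Prod.smul_mk, smul_sub, smul_neg]

/-- The tangent space at `p` of the coadjoint orbit through `p`: all vectors `ad*_ζ p` with
`ζ ∈ 𝔰`, where `⟨ad*_ζ p, η⟩ = ⟨p, [ζ, η]⟩`. -/
def tangent (p : LieDual) : Submodule ℝ LieDual where
  carrier := {δ | ∃ ζ : LieAlg, ∀ η : LieAlg, pair δ η = pair p (lieBr ζ η)}
  add_mem' := by
    rintro a b ⟨ζ, hζ⟩ ⟨ζ', hζ'⟩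
    exact ⟨ζ + ζ', fun η => by rw [pair_add_left, hζ, hζ', lieBr_add_left, pair_add_right]⟩
  zero_mem' := ⟨0, fun η => by
    have h1 := pair_smul_left 0 0 η
    have h2 := lieBr_smul_left 0 0 η
    have h3 := pair_smul_right 0 p (0 : LieAlg)
    simp only [zero_smul, zero_mul] at h1 h2 h3
    rw [h1, h2, h3]⟩
  smul_mem' := by
    rintro c a ⟨ζ, hζ⟩
    exact ⟨c • ζ, fun η => by rw [pair_smul_left, hζ, lieBr_smul_left, pair_smul_right]⟩

/-- The functional derivative `(δf/δm, δf/δn, δf/δA) ∈ 𝔰` of `f : 𝔰* → ℝ` at `p`, that is, the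
differential of `f` at `p` regarded as an element of `𝔰` through `pair` (see `pair_grad`). -/
def grad (f : LieDual → ℝ) (p : LieDual) : LieAlg :=
  (fun i => fderiv ℝ f p (Pi.single i 1, 0, 0),
   fun i => fderiv ℝ f p (0, Pi.single i 1, 0),
   Matrix.of fun i j =>
     (fderiv ℝ f p (0, 0, Pi.single i (Pi.single j 1)) : ℂ)
       + (fderiv ℝ f p (0, 0, Pi.single i (Pi.single j Complex.I)) : ℂ) * Complex.I)

set_option linter.unusedSimpArgs false in
theorem pair_grad (f : LieDual → ℝ) (p δ : LieDual) :
    pair δ (grad f p) = fderiv ℝ f p δ := by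
  generalize hL : fderiv ℝ f p = L
  obtain ⟨m, n, A⟩ := δ
  have hm : L (m, 0, 0) = ∑ i, m i * L (Pi.single i 1, 0, 0) := by
    have h : ((m, 0, 0) : LieDual) = ∑ i, m i • ((Pi.single i 1, 0, 0) : LieDual) := by
      refine Prod.ext ?_ (Prod.ext ?_ ?_) <;>
        simp [Prod.fst_sum, Prod.snd_sum, Fin.sum_univ_three]
      ext k
      fin_cases k <;> simp
    rw [h, map_sum]
    simp only [map_smul, smul_eq_mul]
  have hn : L (0, n, 0) = ∑ i, n i * L (0, Pi.single i 1, 0) := by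
    have h : ((0, n, 0) : LieDual) = ∑ i, n i • ((0, Pi.single i 1, 0) : LieDual) := by
      refine Prod.ext ?_ (Prod.ext ?_ ?_) <;>
        simp [Prod.fst_sum, Prod.snd_sum, Fin.sum_univ_three]
      ext k
      fin_cases k <;> simp
    rw [h, map_sum]
    simp only [map_smul, smul_eq_mul]
  have hA : L (0, 0, A) = ∑ i, ∑ j, ((A i j).re * L (0, 0, Pi.single i (Pi.single j 1))
      + (A i j).im * L (0, 0, Pi.single i (Pi.single j Complex.I))) := by
    have h : ((0, 0, A) : LieDual) = ∑ i, ∑ j,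
        ((A i j).re • ((0, 0, Pi.single i (Pi.single j 1)) : LieDual)
          + (A i j).im • ((0, 0, Pi.single i (Pi.single j Complex.I)) : LieDual)) := by
      refine Prod.ext ?_ (Prod.ext ?_ ?_) <;>
        simp [Prod.fst_sum, Prod.snd_sum, Fin.sum_univ_three]
      ext k l
      fin_cases k <;> fin_cases l <;> apply Complex.ext <;> simp
    rw [h]
    simp only [map_sum, map_add, map_smul, smul_eq_mul]
  have hs : ((m, n, A) : LieDual) = (m, 0, 0) + (0, n, 0) + (0, 0, A) := by simp
  rw [hs, map_add, map_add, hm, hn, hA, ← hs]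
  simp only [pair, grad, hL, mat, ip, dotProduct, Matrix.trace, Matrix.diag, Matrix.mul_apply,
    Matrix.conjTranspose_apply, Matrix.of_apply, Fin.sum_univ_three, Complex.add_re,
    Complex.mul_re, Complex.star_def, Complex.conj_re, Complex.conj_im, Complex.add_im,
    Complex.mul_im, Complex.ofReal_re, Complex.ofReal_im, Complex.I_re, Complex.I_im]
  ring

/-- The Lie-Poisson bracket `{f, g}(p) = ⟨p, [δf/δp, δg/δp]⟩` on `𝔰*`. Its restriction to a
coadjoint orbit is the Poisson bracket of the (Kirillov-Kostant-Souriau) orbit symplectic form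
and depends only on the restrictions of `f` and `g` to the orbit. -/
def poisson (f g : LieDual → ℝ) (p : LieDual) : ℝ :=
  pair p (lieBr (grad f p) (grad g p))

/-- The Lie-Poisson bracket written out. -/
theorem poisson_eq (f g : LieDual → ℝ) (m n : Fin 3 → ℝ) (A : Fin 3 → Fin 3 → ℂ) :
    poisson f g (m, n, A) =
      m ⬝ᵥ ((grad f (m, n, A)).1 ⨯₃ (grad g (m, n, A)).1)
      - n ⬝ᵥ ((grad f (m, n, A)).2.1 ⨯₃ (grad g (m, n, A)).2.1)
      + ip (grad f (m, n, A)).2.2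
          (infAct (grad g (m, n, A)).1 (grad g (m, n, A)).2.1 (Matrix.of A))
      - ip (grad g (m, n, A)).2.2
          (infAct (grad f (m, n, A)).1 (grad f (m, n, A)).2.1 (Matrix.of A)) := by
  have key : ∀ (v w : Fin 3 → ℝ) (B C : Mat3), ip B (infAct v w C) = -ip C (infAct v w B) := by
    intro v w B C
    simp only [ip, infAct, hat, cplx, Matrix.trace, Matrix.diag, Matrix.mul_apply, Matrix.add_apply,
      Matrix.conjTranspose_apply, Fin.sum_univ_three, Matrix.map_apply]
    simp
    ring
  have hsub : ∀ B C D : Mat3, ip B (C - D) = ip B C - ip B D := by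
    intro B C D
    simp [ip, Matrix.mul_sub, Matrix.trace_sub]
  simp only [poisson, pair, lieBr, mat, hsub, dotProduct_neg]
  rw [key _ _ (grad f (m, n, A)).2.2 (Matrix.of A), key _ _ (grad g (m, n, A)).2.2 (Matrix.of A)]
  ring

/-- The functions `f 0, …, f (k - 1)` (given by smooth functions on the ambient space `𝔰*`) form
a completely integrable system on the coadjoint orbit through `p₀`: the orbit has dimension
`2 * k`, the functions are pairwise in involution on the orbit, and the differentials of their
restrictions to the orbit are linearly independent off a subset of the orbit of measure zero.
For a submanifold of dimension `2 * k` the null sets of its smooth (for instance its Liouville)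
measures are exactly its null sets for the `2 * k`-dimensional Hausdorff measure. -/
structure IsCompletelyIntegrable {k : ℕ} (p₀ : LieDual) (f : Fin k → LieDual → ℝ) : Prop where
  smooth : ∀ i, ContDiff ℝ ∞ (f i)
  finrank_tangent : ∀ p ∈ coadjointOrbit p₀, Module.finrank ℝ (tangent p) = 2 * k
  involution : ∀ i j, ∀ p ∈ coadjointOrbit p₀, poisson (f i) (f j) p = 0
  independent : μH[((2 * k : ℕ) : ℝ)] {p | p ∈ coadjointOrbit p₀ ∧
    ¬ LinearIndependent ℝ fun i =>
        ((fderiv ℝ (f i) p : LieDual →L[ℝ] ℝ) : LieDual →ₗ[ℝ] ℝ).domRestrict (tangent p)} = 0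

/-! ### The functions of the A-phase -/

/-- The base point `A₀` of the order parameter orbit. -/
def A₀ : Fin 3 → Fin 3 → ℂ := ![![0, 0, 0], ![0, 0, 0], ![1, Complex.I, 0]]

/-- `Γ = diag(γ₁, γ₁, γ₁ + γ₂ + γ₃)`. -/
def Gam (γ₁ γ₂ γ₃ : ℝ) : Mat3 :=
  cplx (Matrix.diagonal ![γ₁, γ₁, γ₁ + γ₂ + γ₃])

/-- The element `hat m * A + A * hat n` representing a covector at `A`. -/
def covec (p : LieDual) : Mat3 := infAct p.1 p.2.1 (mat p)

/-- The Hamiltonian `h = ¼ ⟨(hat m * A + A * hat n) Γ⁻¹, hat m * A + A * hat n⟩`. -/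
def hHam (γ₁ γ₂ γ₃ : ℝ) (p : LieDual) : ℝ :=
  1 / 4 * ip (covec p * (Gam γ₁ γ₂ γ₃)⁻¹) (covec p)

/-- The velocity `∂_z A` that corresponds to the covector `α = hat m * A + A * hat n` under
`α = 2 (∂_z A) Γ`. -/
def velocity (γ₁ γ₂ γ₃ : ℝ) (p : LieDual) : Mat3 :=
  (1 / 2 : ℝ) • (covec p * (Gam γ₁ γ₂ γ₃)⁻¹)

/-- The momentum map `j_m (A, ∂_z A) = 2 ⟨(∂_z A) Γ, i A⟩` of the circle action
`A ↦ exp (i φ) A`, as a function of `(m, n, A)`. -/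
def jm (γ₁ γ₂ γ₃ : ℝ) (p : LieDual) : ℝ :=
  2 * ip (velocity γ₁ γ₂ γ₃ p * Gam γ₁ γ₂ γ₃) (Complex.I • mat p)

/-- `J₃^orb = - e₃ · n`. -/
def J3orb (p : LieDual) : ℝ := -(p.2.1 2)

/-- `J^spin = m`. -/
def Jspin (p : LieDual) : Fin 3 → ℝ := p.1

/-- `J₃^spin = e₃ · m`. -/
def J3spin (p : LieDual) : ℝ := Jspin p 2

/-- `‖J^spin‖²`, with the Euclidean norm of `ℝ³`. -/
def normSqJspin (p : LieDual) : ℝ := Jspin p ⬝ᵥ Jspin p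

end

end SuperfluidHe3

namespace SuperfluidHe3


/-! ### Rotations -/

/-! A group element rotates `(m, n, A)` and shifts its momenta by a term that depends on a matrix
`V`. Since `e₃` in the first factor annihilates `A₀`, the shift leaves `m 2` fixed, so every orbit
point is `rot g (m, n, A₀)` with `m 2 = m₀ 2` (`exists_rot_of_mem_coadjointOrbit`). The pairing, the
bracket and the tangent spaces are equivariant under `rot`, which moves most computations to `A₀`.
There the rotations give five directions in `A`, and translations give two further directions in `m`
and three in `n`; hence dimension ten (`baseTangent_range`).

Involution is Noether's theorem. The Hamiltonian fields of the three angular momentum functions are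
infinitesimal rotations whose second axis is a multiple of `e₃` (for the squared norm the first axis
is `2m`, which may vary because the bracket is pointwise). Such rotations preserve `h`, as `Γ`
commutes with rotations about `e₃`, and every rotation preserves `j_m`. On the orbit the Hamiltonian
field of `j_m` is `A ↦ -2iA` with the momenta fixed (`pair_lieBr_grad_jm`), an infinitesimal phase
change, which preserves `h`.

For independence let `a` and `l` be the images of `e₃` under the two rotations, and let `M`, `N` be
the momenta at the point. All vectors `(0, k, 0)`, and the vectors `(k, 0, 0)` with `k ⊥ a`, are
tangent. Testing a linear relation on five of them kills its coefficients one at a time, provided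
that the third components of `M × a` and `N × l` are nonzero (`linearIndependent_of_ne_zero`).

Finally, spherical coordinates and an Euler angle cover the orbit by a smooth image of `ℝ¹⁰`, in
which those components are, up to sign, `x 3 * sin (x 0)` and `x 8 * sin (x 4)`. The bad set
therefore lies in countably many smooth images of hyperplanes, of Hausdorff dimension at most nine.
-/

theorem SO3_mul_transpose (P : SO3) :
    (P : Matrix (Fin 3) (Fin 3) ℝ) * (P : Matrix (Fin 3) (Fin 3) ℝ)ᵀ = 1 :=
  (Matrix.mem_orthogonalGroup_iff _ _).1 (Matrix.mem_specialOrthogonalGroup_iff.1 P.2).1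

theorem SO3_transpose_mul (P : SO3) :
    (P : Matrix (Fin 3) (Fin 3) ℝ)ᵀ * (P : Matrix (Fin 3) (Fin 3) ℝ) = 1 :=
  (Matrix.mem_orthogonalGroup_iff' _ _).1 (Matrix.mem_specialOrthogonalGroup_iff.1 P.2).1

theorem SO3_coe_inv (P : SO3) :
    ((P⁻¹ : SO3) : Matrix (Fin 3) (Fin 3) ℝ) = (P : Matrix (Fin 3) (Fin 3) ℝ)ᵀ := rfl

/-- Inverse, transpose and adjugate coincide for a rotation. Replacing the entries by cofactors
turns the equivariance of the cross product and of `hat` into polynomial identities valid for every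
matrix, so that `ring` can prove them. -/
theorem SO3_eq_adjugate_transpose (P : SO3) :
    (P : Matrix (Fin 3) (Fin 3) ℝ) = (P : Matrix (Fin 3) (Fin 3) ℝ).adjugateᵀ := by
  have h : (P : Matrix (Fin 3) (Fin 3) ℝ).adjugate = (P : Matrix (Fin 3) (Fin 3) ℝ)ᵀ := by
    have hd : (P : Matrix (Fin 3) (Fin 3) ℝ).det = 1 :=
      (Matrix.mem_specialOrthogonalGroup_iff.1 P.2).2
    rw [← Matrix.mul_one (Matrix.adjugate _), ← SO3_mul_transpose P, ← Matrix.mul_assoc,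
      Matrix.adjugate_mul, hd, one_smul, Matrix.one_mul]
  rw [h, Matrix.transpose_transpose]

theorem SO3_mulVec_cross (P : SO3) (v w : Fin 3 → ℝ) :
    (P : Matrix (Fin 3) (Fin 3) ℝ) *ᵥ (v ⨯₃ w) =
      ((P : Matrix (Fin 3) (Fin 3) ℝ) *ᵥ v) ⨯₃ ((P : Matrix (Fin 3) (Fin 3) ℝ) *ᵥ w) := by
  conv_lhs => rw [SO3_eq_adjugate_transpose P]
  generalize (P : Matrix (Fin 3) (Fin 3) ℝ) = M
  rw [Matrix.adjugate_fin_three]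
  ext i
  fin_cases i <;>
    simp [cross_apply, Matrix.mulVec, dotProduct, Fin.sum_univ_three] <;> ring

theorem SO3_mulVec_dotProduct (P : SO3) (v w : Fin 3 → ℝ) :
    ((P : Matrix (Fin 3) (Fin 3) ℝ) *ᵥ v) ⬝ᵥ ((P : Matrix (Fin 3) (Fin 3) ℝ) *ᵥ w) = v ⬝ᵥ w := by
  rw [Matrix.dotProduct_mulVec, Matrix.vecMul_mulVec, SO3_transpose_mul, Matrix.vecMul_one]

theorem SO3_inv_mulVec_mulVec (P : SO3) (v : Fin 3 → ℝ) :
    ((P⁻¹ : SO3) : Matrix (Fin 3) (Fin 3) ℝ) *ᵥ ((P : Matrix (Fin 3) (Fin 3) ℝ) *ᵥ v) = v := by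
  rw [SO3_coe_inv, Matrix.mulVec_mulVec, SO3_transpose_mul, Matrix.one_mulVec]

theorem SO3_mulVec_inv_mulVec (P : SO3) (v : Fin 3 → ℝ) :
    (P : Matrix (Fin 3) (Fin 3) ℝ) *ᵥ (((P⁻¹ : SO3) : Matrix (Fin 3) (Fin 3) ℝ) *ᵥ v) = v := by
  rw [SO3_coe_inv, Matrix.mulVec_mulVec, SO3_mul_transpose, Matrix.one_mulVec]

theorem cplx_one : cplx 1 = 1 := Matrix.map_one _ Complex.ofReal_zero Complex.ofReal_one

theorem cplx_conjTranspose (R : Matrix (Fin 3) (Fin 3) ℝ) : (cplx R)ᴴ = cplx Rᵀ := by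
  ext i j
  simp [cplx]

theorem cplx_SO3_inv_mul (P : SO3) :
    cplx ((P⁻¹ : SO3) : Matrix (Fin 3) (Fin 3) ℝ) * cplx (P : Matrix (Fin 3) (Fin 3) ℝ) = 1 := by
  rw [← cplx_mul, SO3_coe_inv, SO3_transpose_mul, cplx_one]

theorem hat_mulVec (P : SO3) (v : Fin 3 → ℝ) :
    hat ((P : Matrix (Fin 3) (Fin 3) ℝ) *ᵥ v) =
      cplx (P : Matrix (Fin 3) (Fin 3) ℝ) * hat v * cplx ((P⁻¹ : SO3) : Matrix (Fin 3) (Fin 3) ℝ) := by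
  conv_lhs => rw [SO3_eq_adjugate_transpose P]
  -- With the inverse written as a transpose, the identity `hat (adj(M)ᵀ v) = M (hat v) Mᵀ` holds
  -- for all `M`, and orthogonality can be forgotten.
  rw [SO3_coe_inv]
  generalize (P : Matrix (Fin 3) (Fin 3) ℝ) = M
  rw [hat, hat, ← cplx_mul, ← cplx_mul, Matrix.adjugate_fin_three]
  congr 1
  ext i j
  fin_cases i <;> fin_cases j <;>
    simp [Matrix.mul_apply, Matrix.mulVec, dotProduct, Fin.sum_univ_three] <;> ring

/-! ### The pairing on `gl(3, ℂ)` -/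

theorem ip_comm (A B : Mat3) : ip A B = ip B A := by
  rw [ip, ip, ← Complex.conj_re, ← Complex.star_def, ← Matrix.trace_conjTranspose,
    Matrix.conjTranspose_mul, Matrix.conjTranspose_conjTranspose]

theorem ip_mul_left (M A B : Mat3) : ip (M * A) B = ip A (Mᴴ * B) := by
  rw [ip, ip, Matrix.conjTranspose_mul, Matrix.mul_assoc]

theorem ip_mul_right (M A B : Mat3) : ip (A * M) B = ip A (B * Mᴴ) := by
  rw [ip, ip, Matrix.conjTranspose_mul, Matrix.mul_assoc, Matrix.trace_mul_comm, Matrix.mul_assoc]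

theorem ip_neg_left (A B : Mat3) : ip (-A) B = -ip A B := by
  simp [ip]

theorem ip_neg_right (A B : Mat3) : ip A (-B) = -ip A B := by
  simp [ip]

theorem ip_sub_right (A B C : Mat3) : ip A (B - C) = ip A B - ip A C := by
  rw [sub_eq_add_neg, ip_add_right, ip_neg_right, sub_eq_add_neg]

theorem ip_I_smul_left (A B : Mat3) : ip (Complex.I • A) B = -ip A (Complex.I • B) := by
  simp [ip]

theorem ip_act (g : SO3 × SO3) (A B : Mat3) : ip (act g A) (act g B) = ip A B := by
  have h1 : (cplx (g.1 : Matrix (Fin 3) (Fin 3) ℝ))ᴴ = cplx ((g.1⁻¹ : SO3) : Matrix _ _ ℝ) :=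
    cplx_conjTranspose _
  have h2 : (cplx ((g.2⁻¹ : SO3) : Matrix (Fin 3) (Fin 3) ℝ))ᴴ = cplx (g.2 : Matrix _ _ ℝ) := by
    rw [cplx_conjTranspose, SO3_coe_inv, Matrix.transpose_transpose]
  rw [act, act, ip_mul_right, ip_mul_left, h1, h2]
  simp only [Matrix.mul_assoc, cplx_SO3_inv_mul, Matrix.mul_one]
  rw [← Matrix.mul_assoc, cplx_SO3_inv_mul, Matrix.one_mul]

theorem infAct_act (g : SO3 × SO3) (v w : Fin 3 → ℝ) (A : Mat3) :
    infAct ((g.1 : Matrix (Fin 3) (Fin 3) ℝ) *ᵥ v) ((g.2 : Matrix (Fin 3) (Fin 3) ℝ) *ᵥ w) (act g A)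
      = act g (infAct v w A) := by
  simp only [infAct, act, hat_mulVec, Matrix.mul_add, Matrix.add_mul]
  congr 1
  · simp only [Matrix.mul_assoc]
    rw [← Matrix.mul_assoc (cplx ((g.1⁻¹ : SO3) : Matrix (Fin 3) (Fin 3) ℝ)), cplx_SO3_inv_mul,
      Matrix.one_mul]
  · simp only [Matrix.mul_assoc]
    rw [← Matrix.mul_assoc (cplx ((g.2⁻¹ : SO3) : Matrix (Fin 3) (Fin 3) ℝ)), cplx_SO3_inv_mul,
      Matrix.one_mul]

theorem act_smul (g : SO3 × SO3) (c : ℝ) (A : Mat3) : act g (c • A) = c • act g A := by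
  simp only [act, Matrix.mul_smul, Matrix.smul_mul]

theorem act_I_smul (g : SO3 × SO3) (A : Mat3) :
    act g (Complex.I • A) = Complex.I • act g A := by
  simp only [act, Matrix.mul_smul, Matrix.smul_mul]

theorem act_neg (g : SO3 × SO3) (A : Mat3) : act g (-A) = -act g A := by
  simp only [act, Matrix.mul_neg, Matrix.neg_mul]

theorem act_sub (g : SO3 × SO3) (A B : Mat3) : act g (A - B) = act g A - act g B := by
  rw [sub_eq_add_neg, act_add, act_neg, sub_eq_add_neg]

theorem act_inv_act (g : SO3 × SO3) (A : Mat3) : act g⁻¹ (act g A) = A := by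
  rw [← act_mul, inv_mul_cancel, act_one]

theorem act_act_inv (g : SO3 × SO3) (A : Mat3) : act g (act g⁻¹ A) = A := by
  rw [← act_mul, mul_inv_cancel, act_one]

open scoped ComplexOrder in
theorem eq_zero_of_ip_self {A : Mat3} (h : ip A A = 0) : A = 0 := by
  -- The hypothesis concerns only the real part; the imaginary part vanishes because `Aᴴ * A` is
  -- Hermitian.
  have h1 : (Aᴴ * A).trace = 0 := by
    apply Complex.ext h
    have := (Matrix.isHermitian_conjTranspose_mul_self A).eq
    have h2 := congrArg Complex.im (Matrix.trace_conjTranspose (Aᴴ * A))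
    rw [this, Complex.star_def, Complex.conj_im] at h2
    simp only [Complex.zero_im]
    linarith
  exact Matrix.trace_conjTranspose_mul_self_eq_zero_iff.1 h1

/-- The pairing between `𝔰*` and `𝔰` is nondegenerate. -/
theorem eq_of_pair_eq {p q : LieDual} (h : ∀ ζ, pair p ζ = pair q ζ) : p = q := by
  have h1 : p.1 = q.1 := by
    have := fun v => h (v, 0, 0)
    simp only [pair, dotProduct_zero, ip, Matrix.mul_zero, Matrix.trace_zero, Complex.zero_re,
      add_zero] at this
    exact dotProduct_eq _ _ this
  have h2 : p.2.1 = q.2.1 := by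
    have := fun v => h (0, v, 0)
    simp only [pair, dotProduct_zero, ip, Matrix.mul_zero, Matrix.trace_zero, Complex.zero_re,
      add_zero, zero_add] at this
    exact dotProduct_eq _ _ this
  have h3 : mat p = mat q := by
    have := fun V => h (0, 0, V)
    simp only [pair, dotProduct_zero, zero_add] at this
    have h4 := eq_zero_of_ip_self (A := mat p - mat q) (by
      conv_lhs => rw [sub_eq_add_neg (mat p), ip_add_left, ip_neg_left, ← sub_eq_add_neg]
      rw [this, sub_self])
    exact sub_eq_zero.1 h4
  exact Prod.ext h1 (Prod.ext h2 h3)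

/-! ### The coadjoint action of the rotations -/

/-- The linear automorphism of `𝔰*` given by the coadjoint action of `g ∈ SO(3) × SO(3)`. -/
def rot (g : SO3 × SO3) : LieDual ≃ₗ[ℝ] LieDual where
  toFun p := ((g.1 : Matrix (Fin 3) (Fin 3) ℝ) *ᵥ p.1, (g.2 : Matrix (Fin 3) (Fin 3) ℝ) *ᵥ p.2.1,
    act g (mat p))
  invFun p := (((g.1⁻¹ : SO3) : Matrix (Fin 3) (Fin 3) ℝ) *ᵥ p.1,
    ((g.2⁻¹ : SO3) : Matrix (Fin 3) (Fin 3) ℝ) *ᵥ p.2.1, act g⁻¹ (mat p))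
  map_add' p q := by
    simp only [Prod.fst_add, Prod.snd_add, Matrix.mulVec_add, mat_add, act_add]
    rfl
  map_smul' c p := by
    simp only [Prod.smul_fst, Prod.smul_snd, Matrix.mulVec_smul, mat_smul, act_smul]
    rfl
  left_inv p := by
    refine Prod.ext (SO3_inv_mulVec_mulVec _ _) (Prod.ext (SO3_inv_mulVec_mulVec _ _) ?_)
    exact act_inv_act g (mat p)
  right_inv p := by
    refine Prod.ext (SO3_mulVec_inv_mulVec _ _) (Prod.ext (SO3_mulVec_inv_mulVec _ _) ?_)
    exact act_act_inv g (mat p)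

/-- The adjoint action of `g ∈ SO(3) × SO(3)` on `𝔰`. -/
def rotAlg (g : SO3 × SO3) (ζ : LieAlg) : LieAlg :=
  ((g.1 : Matrix (Fin 3) (Fin 3) ℝ) *ᵥ ζ.1, (g.2 : Matrix (Fin 3) (Fin 3) ℝ) *ᵥ ζ.2.1,
    act g ζ.2.2)

theorem rotAlg_rotAlg_inv (g : SO3 × SO3) (ζ : LieAlg) : rotAlg g (rotAlg g⁻¹ ζ) = ζ :=
  Prod.ext (SO3_mulVec_inv_mulVec _ _) (Prod.ext (SO3_mulVec_inv_mulVec _ _) (act_act_inv g _))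

theorem mat_rot (g : SO3 × SO3) (p : LieDual) : mat (rot g p) = act g (mat p) := rfl

theorem pair_rot (g : SO3 × SO3) (p : LieDual) (ζ : LieAlg) :
    pair (rot g p) (rotAlg g ζ) = pair p ζ := by
  simp only [pair, mat_rot]
  exact congrArg₂ _ (congrArg₂ _ (SO3_mulVec_dotProduct _ _ _) (SO3_mulVec_dotProduct _ _ _))
    (ip_act _ _ _)

theorem lieBr_rotAlg (g : SO3 × SO3) (ζ η : LieAlg) :
    lieBr (rotAlg g ζ) (rotAlg g η) = rotAlg g (lieBr ζ η) := by
  simp only [lieBr, rotAlg, infAct_act, SO3_mulVec_cross, act_sub, Matrix.mulVec_neg]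

theorem rot_mem_tangent_rot (g : SO3 × SO3) {p δ : LieDual} (h : δ ∈ tangent p) :
    rot g δ ∈ tangent (rot g p) := by
  obtain ⟨ζ, hζ⟩ := h
  refine ⟨rotAlg g ζ, fun η => ?_⟩
  rw [← rotAlg_rotAlg_inv g η, pair_rot, lieBr_rotAlg, pair_rot, hζ]

theorem tangent_rot (g : SO3 × SO3) (p : LieDual) :
    tangent (rot g p) = (tangent p).map (rot g : LieDual →ₗ[ℝ] LieDual) := by
  ext δ
  constructor
  · intro h
    refine ⟨(rot g).symm δ, ?_, (rot g).apply_symm_apply δ⟩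
    have h1 := rot_mem_tangent_rot g⁻¹ h
    have h2 : ∀ q, rot g⁻¹ q = (rot g).symm q := fun q => rfl
    rwa [h2, h2, LinearEquiv.symm_apply_apply] at h1
  · rintro ⟨δ, h, rfl⟩
    exact rot_mem_tangent_rot g h

theorem finrank_tangent_rot (g : SO3 × SO3) (p : LieDual) :
    Module.finrank ℝ (tangent (rot g p)) = Module.finrank ℝ (tangent p) := by
  rw [tangent_rot]
  exact LinearEquiv.finrank_map_eq (rot g) (tangent p)


theorem hat_conjTranspose (v : Fin 3 → ℝ) : (hat v)ᴴ = -hat v := by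
  ext i j
  fin_cases i <;> fin_cases j <;> simp [hat, cplx]

/-- Rotations are orthogonal for `ip`, so their generators are skew. -/
theorem ip_infAct_right (v w : Fin 3 → ℝ) (A B : Mat3) :
    ip A (infAct v w B) = -ip (infAct v w A) B := by
  rw [infAct, infAct, ip_add_right, ip_add_left, ip_mul_left, ip_mul_right, hat_conjTranspose,
    hat_conjTranspose, Matrix.neg_mul, Matrix.mul_neg, ip_neg_right, ip_neg_right]
  ring

/-! ### The tangent spaces -/

/-- The matrix with array of entries `A₀`. -/
abbrev baseMat : Mat3 := Matrix.of A₀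

/-- Two facts are visible here: `v 2` does not occur, so the stabilizer of `A₀` is the line of `e₃`
in the first factor; and `w = e₃` acts on `A₀` as multiplication by `i`. -/
theorem infAct_baseMat (v w : Fin 3 → ℝ) :
    infAct v w baseMat = !![(v 1 : ℂ), v 1 * Complex.I, 0; -v 0, -v 0 * Complex.I, 0;
      w 2 * Complex.I, -w 2, w 1 - w 0 * Complex.I] := by
  ext i j
  fin_cases i <;> fin_cases j <;>
    simp [infAct, hat, cplx, A₀, Matrix.mul_apply, Fin.sum_univ_three] <;> ring

/-- A linear parametrization of the tangent space at `(m, n, A₀)`. -/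
noncomputable def baseTangent (m : Fin 3 → ℝ) :
    ((Fin 3 → ℝ) × (Fin 3 → ℝ) × (Fin 2 → ℝ) × (Fin 2 → ℝ)) →ₗ[ℝ] LieDual where
  toFun t := (![t.2.2.1 0, t.2.2.1 1, m 0 * t.2.2.2 1 - m 1 * t.2.2.2 0], t.1,
    -infAct ![t.2.2.2 0, t.2.2.2 1, 0] t.2.1 baseMat)
  map_add' s t := by
    refine Prod.ext ?_ (Prod.ext rfl ?_)
    · ext i
      fin_cases i <;> simp
      ring
    · change -infAct _ _ baseMat = -infAct _ _ baseMat + -infAct _ _ baseMat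
      rw [← neg_add, ← infAct_add]
      simp
  map_smul' c t := by
    refine Prod.ext ?_ (Prod.ext rfl ?_)
    · ext i
      fin_cases i <;> simp
      ring
    · change -infAct _ _ baseMat = c • -infAct _ _ baseMat
      rw [smul_neg, ← infAct_smul]
      simp

theorem baseTangent_injective (m : Fin 3 → ℝ) : Function.Injective (baseTangent m) := by
  rw [← LinearMap.ker_eq_bot, LinearMap.ker_eq_bot']
  rintro ⟨y, w, x, v⟩ h
  have h1 := congrArg Prod.fst h
  have h2 : y = 0 := congrArg (fun q => q.2.1) h
  have h3 : -infAct ![v 0, v 1, 0] w baseMat = 0 := congrArg (fun q => q.2.2) h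
  have h1' : ![x 0, x 1, m 0 * v 1 - m 1 * v 0] = 0 := h1
  rw [neg_eq_zero, infAct_baseMat] at h3
  have e1 := congrFun h1' 0
  have e2 := congrFun h1' 1
  have e3 := congrFun (congrFun h3 0) 0
  have e4 := congrFun (congrFun h3 1) 0
  have e5 := congrFun (congrFun h3 2) 1
  have e6 := congrArg Complex.re (congrFun (congrFun h3 2) 2)
  have e7 := congrArg Complex.im (congrFun (congrFun h3 2) 2)
  simp at e1 e2 e3 e4 e5 e6 e7
  refine Prod.ext h2 (Prod.ext ?_ (Prod.ext ?_ ?_)) <;> ext i <;> fin_cases i <;> simp [*]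

theorem baseTangent_range (m n : Fin 3 → ℝ) :
    LinearMap.range (baseTangent m) = tangent (m, n, A₀) := by
  ext δ
  constructor
  · rintro ⟨⟨y, w, x, v⟩, rfl⟩
    let a : Fin 3 → ℝ := m ⨯₃ ![v 0, v 1, 0]
    let b : Fin 3 → ℝ := -(n ⨯₃ w) - y
    -- The rotation part must produce the given variation of `A`, and `v 2` may be zero because it
    -- acts trivially. It changes the momenta by `a` and `-(n × w)`; the matrix entries solve the
    -- linear equations by which the translation part corrects these to the prescribed values. The
    -- third component of `m` cannot be corrected.
    refine ⟨(![v 0, v 1, 0], w, !![((x 1 - a 1 : ℝ) : ℂ), 0, 0; ((a 0 - x 0 : ℝ) : ℂ), 0, 0;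
      0, (b 2 : ℂ), -b 1 + b 0 * Complex.I]), fun η => ?_⟩
    simp only [pair, lieBr, ip_sub_right, ip_infAct_right]
    have h : mat (baseTangent m (y, w, x, v)) = -infAct ![v 0, v 1, 0] w baseMat := rfl
    have h' : mat (m, n, A₀) = baseMat := rfl
    rw [h, h', ip_neg_left, infAct_baseMat η.1]
    simp [baseTangent, cross_apply, dotProduct, Fin.sum_univ_three, a, b, ip, Matrix.trace,
      Matrix.mul_apply, Matrix.vecHead, Matrix.vecTail]
    ring
  · rintro ⟨⟨v, w, V⟩, h⟩
    refine ⟨(δ.2.1, w, ![δ.1 0, δ.1 1], ![v 0, v 1]), ?_⟩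
    refine Prod.ext ?_ (Prod.ext rfl ?_)
    -- Testing against the stabilizer direction removes the translation part and determines the
    -- third component.
    · have h1 := h (Pi.single 2 1, 0, 0)
      have h' : mat (m, n, A₀) = baseMat := rfl
      simp only [pair, lieBr, ip_sub_right, ip_infAct_right, h', infAct_baseMat] at h1
      simp [ip, Matrix.trace, Matrix.mul_apply, cross_apply, dotProduct, Fin.sum_univ_three] at h1
      ext i
      fin_cases i <;> simp [baseTangent, h1]
      ring
    · change -infAct _ _ baseMat = mat δ
      have h1 : mat δ + infAct v w baseMat = 0 := by
        apply eq_zero_of_ip_self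
        -- The discrepancy is paired with itself, and definiteness of `ip` finishes.
        have h2 := h (0, 0, mat δ + infAct v w baseMat)
        have h' : mat (m, n, A₀) = baseMat := rfl
        have h0 : infAct 0 0 baseMat = 0 := by simpa using infAct_smul 0 0 0 baseMat
        simp only [pair, lieBr, ip_sub_right, ip_infAct_right, h', h0] at h2
        rw [ip_add_left]
        simp only [dotProduct_zero, map_zero, neg_zero, zero_add] at h2
        rw [h2]
        simp [ip]
      rw [eq_neg_of_add_eq_zero_left h1, infAct_baseMat, infAct_baseMat]
      simp

theorem finrank_tangent_base (m n : Fin 3 → ℝ) :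
    Module.finrank ℝ (tangent (m, n, A₀)) = 10 := by
  rw [← baseTangent_range, LinearMap.finrank_range_of_inj (baseTangent_injective m)]
  simp


/-! ### Points of the orbit -/

theorem exists_rot_of_mem_coadjointOrbit {m₀ n₀ : Fin 3 → ℝ} {p : LieDual}
    (hp : p ∈ coadjointOrbit (m₀, n₀, A₀)) :
    ∃ (g : SO3 × SO3) (m n : Fin 3 → ℝ), m 2 = m₀ 2 ∧ p = rot g (m, n, A₀) := by
  obtain ⟨s, hs⟩ := hp
  let g : SO3 × SO3 := s.right
  let q : LieDual := rot g⁻¹ p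
  have hq : rot g q = p := LinearEquiv.apply_symm_apply (rot g) p
  have key : ∀ ζ : LieAlg, pair q ζ = m₀ ⬝ᵥ ζ.1 + n₀ ⬝ᵥ ζ.2.1 +
      ip baseMat (ζ.2.2 - infAct ζ.1 ζ.2.1 (s⁻¹).left.toAdd) := by
    intro ζ
    -- Rotating the test vector by `g` cancels the rotation in `Ad s⁻¹`, so only the translation
    -- part of `s⁻¹` remains.
    have hA : Ad s⁻¹ (rotAlg g ζ) =
        (ζ.1, ζ.2.1, ζ.2.2 - infAct ζ.1 ζ.2.1 (s⁻¹).left.toAdd) := by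
      have hr : (s⁻¹).right = g⁻¹ := rfl
      have h1 : (((s⁻¹).right.1 : SO3) : Matrix (Fin 3) (Fin 3) ℝ) *ᵥ (rotAlg g ζ).1 = ζ.1 :=
        SO3_inv_mulVec_mulVec g.1 ζ.1
      have h2 : (((s⁻¹).right.2 : SO3) : Matrix (Fin 3) (Fin 3) ℝ) *ᵥ (rotAlg g ζ).2.1 = ζ.2.1 :=
        SO3_inv_mulVec_mulVec g.2 ζ.2.1
      have h3 : act (s⁻¹).right (rotAlg g ζ).2.2 = ζ.2.2 := act_inv_act g ζ.2.2
      simp only [Ad, h1, h2, h3]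
    rw [← pair_rot g, hq, hs, hA]
    rfl
  have h3 : mat q = baseMat := by
    have h : mat q + -baseMat = 0 := by
      apply eq_zero_of_ip_self
      have h1 := key (0, 0, mat q + -baseMat)
      have h0 : infAct 0 0 (s⁻¹).left.toAdd = 0 := by
        simpa using infAct_smul 0 0 0 (s⁻¹).left.toAdd
      simp only [pair, dotProduct_zero, zero_add, h0, sub_zero] at h1
      rw [ip_add_left, h1, ip_neg_left, add_neg_cancel]
    rwa [add_neg_eq_zero] at h
  have h1 : q.1 2 = m₀ 2 := by
    have h := key (Pi.single 2 1, 0, 0)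
    rw [ip_sub_right, ip_infAct_right, infAct_baseMat] at h
    simpa [pair, ip, Matrix.trace, Matrix.mul_apply, Fin.sum_univ_three] using h
  exact ⟨g, q.1, q.2.1, h1, by rw [← hq]; exact congrArg (rot g) (Prod.ext rfl (Prod.ext rfl h3))⟩

/-! ### Smoothness -/

theorem contDiff_ip {X Y : LieDual → Mat3} (hX : ∀ i j, ContDiff ℝ ∞ fun p => X p i j)
    (hY : ∀ i j, ContDiff ℝ ∞ fun p => Y p i j) : ContDiff ℝ ∞ fun p => ip (X p) (Y p) := by
  have hc : ∀ i j, ContDiff ℝ ∞ fun p => star (X p i j) := fun i j =>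
    Complex.conjCLE.contDiff.comp (hX i j)
  have h : ContDiff ℝ ∞ fun p => ((X p)ᴴ * Y p).trace := by
    simp only [Matrix.trace, Matrix.diag, Matrix.mul_apply, Matrix.conjTranspose_apply]
    exact ContDiff.sum fun i _ => ContDiff.sum fun j _ => (hc j i).mul (hY j i)
  exact Complex.reCLM.contDiff.comp h

theorem contDiff_mul_const {X : LieDual → Mat3} (hX : ∀ i j, ContDiff ℝ ∞ fun p => X p i j)
    (M : Mat3) (i j : Fin 3) : ContDiff ℝ ∞ fun p => (X p * M) i j := by
  simp only [Matrix.mul_apply]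
  exact ContDiff.sum fun k _ => (hX i k).mul contDiff_const

theorem contDiff_mat (i j : Fin 3) : ContDiff ℝ ∞ fun p : LieDual => mat p i j := by
  have : (fun p : LieDual => mat p i j) = fun p => p.2.2 i j := rfl
  rw [this]
  fun_prop

theorem contDiff_covec (i j : Fin 3) : ContDiff ℝ ∞ fun p : LieDual => covec p i j := by
  have hc : ∀ {f : LieDual → ℝ}, ContDiff ℝ ∞ f → ContDiff ℝ ∞ fun p => (f p : ℂ) :=
    fun hf => Complex.ofRealCLM.contDiff.comp hf
  have h1 : ∀ i j, ContDiff ℝ ∞ fun p : LieDual => hat p.1 i j := by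
    intro i j
    apply hc
    fin_cases i <;> fin_cases j <;> simp <;> fun_prop
  have h2 : ∀ i j, ContDiff ℝ ∞ fun p : LieDual => hat p.2.1 i j := by
    intro i j
    apply hc
    fin_cases i <;> fin_cases j <;> simp <;> fun_prop
  simp only [covec, infAct, Matrix.add_apply, Matrix.mul_apply]
  exact (ContDiff.sum fun k _ => (h1 i k).mul (contDiff_mat k j)).add
    (ContDiff.sum fun k _ => (contDiff_mat i k).mul (h2 k j))

theorem contDiff_hHam (γ₁ γ₂ γ₃ : ℝ) : ContDiff ℝ ∞ (hHam γ₁ γ₂ γ₃) :=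
  contDiff_const.mul (contDiff_ip (contDiff_mul_const contDiff_covec _) contDiff_covec)

theorem contDiff_J3orb : ContDiff ℝ ∞ J3orb := by
  unfold J3orb; fun_prop

theorem contDiff_J3spin : ContDiff ℝ ∞ J3spin := by
  unfold J3spin Jspin; fun_prop

theorem contDiff_normSqJspin : ContDiff ℝ ∞ normSqJspin := by
  unfold normSqJspin Jspin dotProduct; fun_prop

/-! ### The weight matrix -/

theorem Gam_isUnit_det {γ₁ γ₂ γ₃ : ℝ} (hγ₁ : 0 < γ₁) (hγ₂ : 0 < γ₂) (hγ₃ : 0 < γ₃) :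
    IsUnit (Gam γ₁ γ₂ γ₃).det := by
  have h : Gam γ₁ γ₂ γ₃ =
      Matrix.diagonal fun i => ((![γ₁, γ₁, γ₁ + γ₂ + γ₃] i : ℝ) : ℂ) := by
    rw [Gam, cplx, Matrix.diagonal_map Complex.ofReal_zero]
  have h3 : ((γ₁ + γ₂ + γ₃ : ℝ) : ℂ) ≠ 0 := Complex.ofReal_ne_zero.2 (by positivity)
  rw [h, Matrix.det_diagonal, Fin.prod_univ_three, isUnit_iff_ne_zero]
  exact mul_ne_zero (mul_ne_zero (Complex.ofReal_ne_zero.2 hγ₁.ne')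
    (Complex.ofReal_ne_zero.2 hγ₁.ne')) h3

theorem Gam_inv {γ₁ γ₂ γ₃ : ℝ} (hγ₁ : 0 < γ₁) (hγ₂ : 0 < γ₂) (hγ₃ : 0 < γ₃) :
    (Gam γ₁ γ₂ γ₃)⁻¹ = cplx (Matrix.diagonal ![γ₁⁻¹, γ₁⁻¹, (γ₁ + γ₂ + γ₃)⁻¹]) := by
  apply Matrix.inv_eq_left_inv
  have h3 : γ₁ + γ₂ + γ₃ ≠ 0 := by positivity
  rw [Gam, ← cplx_mul, Matrix.diagonal_mul_diagonal, ← cplx_one, ← Matrix.diagonal_one]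
  congr 2
  ext i
  fin_cases i <;> simp [hγ₁.ne', h3]

theorem cplx_diagonal_conjTranspose (d : Fin 3 → ℝ) :
    (cplx (Matrix.diagonal d))ᴴ = cplx (Matrix.diagonal d) := by
  rw [cplx_conjTranspose, Matrix.diagonal_transpose]

/-- The weights `Γ⁻¹` and `Γ` cancel, which leaves a polynomial independent of the `γ`'s. -/
theorem jm_eq {γ₁ γ₂ γ₃ : ℝ} (hγ₁ : 0 < γ₁) (hγ₂ : 0 < γ₂) (hγ₃ : 0 < γ₃) (p : LieDual) :
    jm γ₁ γ₂ γ₃ p = ip (covec p) (Complex.I • mat p) := by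
  rw [jm, velocity, Matrix.smul_mul, Matrix.nonsing_inv_mul_cancel_right _ _
    (Gam_isUnit_det hγ₁ hγ₂ hγ₃), ip_smul_left]
  ring

theorem contDiff_jm {γ₁ γ₂ γ₃ : ℝ} (hγ₁ : 0 < γ₁) (hγ₂ : 0 < γ₂) (hγ₃ : 0 < γ₃) :
    ContDiff ℝ ∞ (jm γ₁ γ₂ γ₃) := by
  have h : jm γ₁ γ₂ γ₃ = fun p => ip (covec p) (Complex.I • mat p) :=
    funext fun p => jm_eq hγ₁ hγ₂ hγ₃ p
  rw [h]
  exact contDiff_ip contDiff_covec fun i j => contDiff_const.mul (contDiff_mat i j)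

/-! ### Differentials -/

/-- All five functions are polynomials of degree at most four, as `covec` is quadratic. Their
differentials are therefore read off as the coefficient of `t` along a line. -/
theorem fderiv_eq_of_quartic {f : LieDual → ℝ} {p δ : LieDual} (hf : ContDiff ℝ ∞ f)
    {c₁ c₂ c₃ c₄ : ℝ}
    (h : ∀ t : ℝ, f (p + t • δ) = f p + t * c₁ + t ^ 2 * c₂ + t ^ 3 * c₃ + t ^ 4 * c₄) :
    fderiv ℝ f p δ = c₁ := by
  have hd : DifferentiableAt ℝ f p := (hf.differentiable (by simp)).differentiableAt
  rw [← hd.lineDeriv_eq_fderiv]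
  apply HasLineDerivAt.lineDeriv
  unfold HasLineDerivAt
  simp only [h]
  have h1 : HasDerivAt (fun t : ℝ => f p + t * c₁ + t ^ 2 * c₂ + t ^ 3 * c₃ + t ^ 4 * c₄)
      (0 + 1 * c₁ + ((2 : ℕ) * (0 : ℝ) ^ 1 * 1) * c₂ + ((3 : ℕ) * (0 : ℝ) ^ 2 * 1) * c₃ +
        ((4 : ℕ) * (0 : ℝ) ^ 3 * 1) * c₄) 0 :=
    (((((hasDerivAt_const _ _).add ((hasDerivAt_id _).mul_const _)).add
      (((hasDerivAt_id _).pow 2).mul_const _)).add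
      (((hasDerivAt_id _).pow 3).mul_const _)).add (((hasDerivAt_id _).pow 4).mul_const _))
  simpa using h1

/-- The differential of `covec` at `p` in the direction `δ`. -/
def dcovec (p δ : LieDual) : Mat3 :=
  infAct δ.1 δ.2.1 (mat p) + infAct p.1 p.2.1 (mat δ)

theorem covec_add_smul (p δ : LieDual) (t : ℝ) :
    covec (p + t • δ) = covec p + t • dcovec p δ + t ^ 2 • covec δ := by
  simp only [covec, dcovec, mat_add, mat_smul, Prod.fst_add, Prod.snd_add, Prod.smul_fst,
    Prod.smul_snd, infAct_add, infAct_add_right, infAct_smul, infAct_smul_right, smul_add]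
  module

theorem ip_mul_cplx_diagonal (d : Fin 3 → ℝ) (A B : Mat3) :
    ip (A * cplx (Matrix.diagonal d)) B = ip A (B * cplx (Matrix.diagonal d)) := by
  rw [ip_mul_right, cplx_diagonal_conjTranspose]

theorem fderiv_hHam {γ₁ γ₂ γ₃ : ℝ} (hγ₁ : 0 < γ₁) (hγ₂ : 0 < γ₂) (hγ₃ : 0 < γ₃)
    (p δ : LieDual) :
    fderiv ℝ (hHam γ₁ γ₂ γ₃) p δ =
      1 / 2 * ip (covec p * (Gam γ₁ γ₂ γ₃)⁻¹) (dcovec p δ) := by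
  have hD : ∀ A B : Mat3, ip (A * (Gam γ₁ γ₂ γ₃)⁻¹) B = ip (B * (Gam γ₁ γ₂ γ₃)⁻¹) A := by
    intro A B
    rw [Gam_inv hγ₁ hγ₂ hγ₃, ip_mul_cplx_diagonal, ip_comm]
  generalize hDef : (Gam γ₁ γ₂ γ₃)⁻¹ = D at hD
  refine fderiv_eq_of_quartic (contDiff_hHam γ₁ γ₂ γ₃)
    (c₂ := 1 / 4 * (ip (dcovec p δ * D) (dcovec p δ) + 2 * ip (covec p * D) (covec δ)))
    (c₃ := 1 / 2 * ip (dcovec p δ * D) (covec δ)) (c₄ := 1 / 4 * ip (covec δ * D) (covec δ))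
    fun t => ?_
  simp only [hHam, covec_add_smul, hDef, Matrix.add_mul, Matrix.smul_mul, ip_add_left,
    ip_add_right, ip_smul_left, ip_smul_right]
  rw [hD (dcovec p δ) (covec p), hD (covec δ) (covec p), hD (covec δ) (dcovec p δ)]
  ring

theorem fderiv_jm {γ₁ γ₂ γ₃ : ℝ} (hγ₁ : 0 < γ₁) (hγ₂ : 0 < γ₂) (hγ₃ : 0 < γ₃)
    (p δ : LieDual) :
    fderiv ℝ (jm γ₁ γ₂ γ₃) p δ =
      ip (dcovec p δ) (Complex.I • mat p) + ip (covec p) (Complex.I • mat δ) := by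
  refine fderiv_eq_of_quartic (contDiff_jm hγ₁ hγ₂ hγ₃)
    (c₂ := ip (covec δ) (Complex.I • mat p) + ip (dcovec p δ) (Complex.I • mat δ))
    (c₃ := ip (covec δ) (Complex.I • mat δ)) (c₄ := 0) fun t => ?_
  simp only [jm_eq hγ₁ hγ₂ hγ₃, covec_add_smul, mat_add, mat_smul, smul_add,
    smul_comm Complex.I t, ip_add_left, ip_add_right, ip_smul_left, ip_smul_right]
  ring

theorem fderiv_J3orb (p δ : LieDual) : fderiv ℝ J3orb p δ = -(δ.2.1 2) :=
  fderiv_eq_of_quartic contDiff_J3orb (c₂ := 0) (c₃ := 0) (c₄ := 0) fun t => by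
    simp [J3orb]; ring

theorem fderiv_J3spin (p δ : LieDual) : fderiv ℝ J3spin p δ = δ.1 2 :=
  fderiv_eq_of_quartic contDiff_J3spin (c₂ := 0) (c₃ := 0) (c₄ := 0) fun t => by
    simp [J3spin, Jspin]

theorem fderiv_normSqJspin (p δ : LieDual) :
    fderiv ℝ normSqJspin p δ = 2 * (p.1 ⬝ᵥ δ.1) :=
  fderiv_eq_of_quartic contDiff_normSqJspin (c₂ := δ.1 ⬝ᵥ δ.1) (c₃ := 0) (c₄ := 0) fun t => by
    simp only [normSqJspin, Jspin, Prod.fst_add, Prod.smul_fst, add_dotProduct, dotProduct_add,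
      smul_dotProduct, dotProduct_smul, smul_eq_mul, dotProduct_comm δ.1 p.1]
    ring


/-! ### Involution -/

theorem pair_comm (p q : LieDual) : pair p (q.1, q.2.1, mat q) = pair q (p.1, p.2.1, mat p) := by
  simp only [pair, ip_comm (mat p), dotProduct_comm p.1, dotProduct_comm p.2.1]

/-- Both `𝔰` and `𝔰*` are stored as triples and `pair` is symmetric in them, so nondegeneracy on one
side gives it on the other. -/
theorem eq_of_forall_pair_eq {ζ η : LieAlg} (h : ∀ δ, pair δ ζ = pair δ η) : ζ = η := by
  have h1 : ∀ θ : LieAlg, pair (ζ : LieDual) θ = pair (η : LieDual) θ := by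
    intro θ
    have e1 := pair_comm (ζ : LieDual) (θ : LieDual)
    have e2 := pair_comm (η : LieDual) (θ : LieDual)
    exact e1.trans ((h θ).trans e2.symm)
  exact eq_of_pair_eq h1

theorem grad_eq {f : LieDual → ℝ} {p : LieDual} {ζ : LieAlg}
    (h : ∀ δ, fderiv ℝ f p δ = pair δ ζ) : grad f p = ζ :=
  eq_of_forall_pair_eq fun δ => by rw [pair_grad, h]

theorem lieBr_antisymm (ζ η : LieAlg) : lieBr ζ η = -lieBr η ζ := by
  refine Prod.ext ?_ (Prod.ext ?_ ?_)
  · exact (cross_anticomm _ _).symm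
  · exact congrArg Neg.neg (cross_anticomm _ _).symm
  · exact (neg_sub _ _).symm

theorem poisson_antisymm (f g : LieDual → ℝ) (p : LieDual) : poisson f g p = -poisson g f p := by
  have h : -lieBr (grad g p) (grad f p) = (-1 : ℝ) • lieBr (grad g p) (grad f p) := by simp
  rw [poisson, lieBr_antisymm, h, pair_smul_right, poisson]
  ring

theorem poisson_self (f : LieDual → ℝ) (p : LieDual) : poisson f f p = 0 := by
  linarith [poisson_antisymm f f p]

theorem poisson_eq_fderiv {f g : LieDual → ℝ} {p X : LieDual}
    (hX : ∀ η, pair X η = pair p (lieBr (grad f p) η)) : poisson f g p = fderiv ℝ g p X := by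
  rw [poisson, ← hX, pair_grad]

/-- The vector field on `𝔰*` generated by the rotation `(v, w)`. -/
def rotField (v w : Fin 3 → ℝ) (p : LieDual) : LieDual :=
  (p.1 ⨯₃ v, -(p.2.1 ⨯₃ w), -infAct v w (mat p))

theorem pair_rotField (v w : Fin 3 → ℝ) (p : LieDual) (η : LieAlg) :
    pair (rotField v w p) η = pair p (lieBr (v, w, 0) η) := by
  have h : mat (rotField v w p) = -infAct v w (mat p) := rfl
  have h0 : infAct η.1 η.2.1 0 = 0 := by simp [infAct]
  simp only [pair, lieBr, h, ip_neg_left, h0, sub_zero, ip_infAct_right]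
  have key : ∀ a b c : Fin 3 → ℝ, (a ⨯₃ b) ⬝ᵥ c = a ⬝ᵥ b ⨯₃ c := fun a b c => by
    rw [dotProduct_comm, triple_product_permutation]
  simp only [rotField, neg_dotProduct, dotProduct_neg, key]

theorem poisson_eq_fderiv_rotField {f g : LieDual → ℝ} {p : LieDual} {v w : Fin 3 → ℝ}
    (hf : ∀ δ, fderiv ℝ f p δ = v ⬝ᵥ δ.1 + w ⬝ᵥ δ.2.1) :
    poisson f g p = fderiv ℝ g p (rotField v w p) := by
  apply poisson_eq_fderiv
  rw [grad_eq (ζ := (v, w, 0))]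
  · exact pair_rotField v w p
  · intro δ
    simp [hf, pair, ip, dotProduct_comm]

theorem hat_cross (v w : Fin 3 → ℝ) : hat (v ⨯₃ w) = hat v * hat w - hat w * hat v := by
  ext i j
  fin_cases i <;> fin_cases j <;>
    simp [hat, cplx, cross_apply, Matrix.mul_apply, Fin.sum_univ_three] <;> ring

theorem hat_neg (v : Fin 3 → ℝ) : hat (-v) = -hat v := by
  ext i j
  fin_cases i <;> fin_cases j <;> simp [hat, cplx]

/-- This is the infinitesimal equivariance of `covec`: by `hat_cross`, the commutator of the actions
of `(m, n)` and `(v, w)` is the action of `(m × v, -(n × w))`. -/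
theorem dcovec_rotField (v w : Fin 3 → ℝ) (p : LieDual) :
    dcovec p (rotField v w p) = -infAct v w (covec p) := by
  have h : mat (rotField v w p) = -infAct v w (mat p) := rfl
  rw [dcovec, h]
  simp only [rotField, covec, infAct, hat_cross, hat_neg]
  noncomm_ring

theorem infAct_I_smul (v w : Fin 3 → ℝ) (A : Mat3) :
    infAct v w (Complex.I • A) = Complex.I • infAct v w A := by
  simp only [infAct, Matrix.mul_smul, Matrix.smul_mul, smul_add]

theorem fderiv_jm_rotField {γ₁ γ₂ γ₃ : ℝ} (hγ₁ : 0 < γ₁) (hγ₂ : 0 < γ₂) (hγ₃ : 0 < γ₃)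
    (v w : Fin 3 → ℝ) (p : LieDual) :
    fderiv ℝ (jm γ₁ γ₂ γ₃) p (rotField v w p) = 0 := by
  have h : mat (rotField v w p) = -infAct v w (mat p) := rfl
  rw [fderiv_jm hγ₁ hγ₂ hγ₃, dcovec_rotField, h, smul_neg, ← infAct_I_smul, ip_neg_left,
    ip_neg_right, ip_infAct_right]
  ring

theorem hat_single_commute_diagonal (a b c : ℝ) :
    Commute (hat (c • Pi.single 2 1)) (cplx (Matrix.diagonal ![a, a, b])) := by
  rw [Commute, SemiconjBy, hat, ← cplx_mul, ← cplx_mul]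
  congr 1
  ext i j
  fin_cases i <;> fin_cases j <;>
    simp [Matrix.mul_apply, Matrix.diagonal] <;> ring

/-- The generator commutes with right multiplication by `Γ⁻¹`, because `γ₁` is repeated. It is skew
and the weight is symmetric, so the quadratic form `h` is stationary. -/
theorem fderiv_hHam_rotField {γ₁ γ₂ γ₃ : ℝ} (hγ₁ : 0 < γ₁) (hγ₂ : 0 < γ₂) (hγ₃ : 0 < γ₃)
    (v : Fin 3 → ℝ) (c : ℝ) (p : LieDual) :
    fderiv ℝ (hHam γ₁ γ₂ γ₃) p (rotField v (c • Pi.single 2 1) p) = 0 := by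
  have hD := hat_single_commute_diagonal γ₁⁻¹ (γ₁ + γ₂ + γ₃)⁻¹ c
  rw [fderiv_hHam hγ₁ hγ₂ hγ₃, dcovec_rotField, ip_neg_right, Gam_inv hγ₁ hγ₂ hγ₃]
  generalize (c • Pi.single 2 1 : Fin 3 → ℝ) = w at hD ⊢
  have h1 : ∀ A : Mat3, infAct v w (A * cplx (Matrix.diagonal ![γ₁⁻¹, γ₁⁻¹, (γ₁ + γ₂ + γ₃)⁻¹])) =
      infAct v w A * cplx (Matrix.diagonal ![γ₁⁻¹, γ₁⁻¹, (γ₁ + γ₂ + γ₃)⁻¹]) := by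
    intro A
    simp only [infAct, Matrix.add_mul, Matrix.mul_assoc, hD.eq]
  have h2 := ip_infAct_right v w
    (covec p * cplx (Matrix.diagonal ![γ₁⁻¹, γ₁⁻¹, (γ₁ + γ₂ + γ₃)⁻¹])) (covec p)
  rw [h1, ip_mul_cplx_diagonal (_) (infAct v w (covec p)), ip_comm (infAct v w (covec p))] at h2
  linarith

theorem covec_rot (g : SO3 × SO3) (p : LieDual) : covec (rot g p) = act g (covec p) :=
  infAct_act g _ _ _

theorem dcovec_rot (g : SO3 × SO3) (p δ : LieDual) :
    dcovec (rot g p) (rot g δ) = act g (dcovec p δ) := by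
  rw [dcovec, dcovec, act_add, ← infAct_act, ← infAct_act]
  rfl

theorem covec_base (m n : Fin 3 → ℝ) : covec (m, n, A₀) = infAct m n baseMat := rfl

/-- Multiplication by `i` on `A₀` is the action of `e₃` in the second factor, and it is orthogonal
to the directions moved by the first factor. Hence there is no `m` component, and the factor `2` is
`‖A₀‖²`. -/
theorem grad_jm_rot {γ₁ γ₂ γ₃ : ℝ} (hγ₁ : 0 < γ₁) (hγ₂ : 0 < γ₂) (hγ₃ : 0 < γ₃)
    (g : SO3 × SO3) (m n : Fin 3 → ℝ) :
    grad (jm γ₁ γ₂ γ₃) (rot g (m, n, A₀)) =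
      rotAlg g (0, (2 : ℝ) • Pi.single 2 1, (-2 : ℝ) • Complex.I • covec (m, n, A₀)) := by
  apply grad_eq
  intro δ
  obtain ⟨δ, rfl⟩ := (rot g).surjective δ
  rw [pair_rot, fderiv_jm hγ₁ hγ₂ hγ₃, dcovec_rot, covec_rot, mat_rot, mat_rot, ← act_I_smul,
    ← act_I_smul, ip_act, ip_act]
  have h : mat (m, n, A₀) = baseMat := rfl
  have h1 : ip (infAct m n (mat δ)) (Complex.I • baseMat) =
      -ip (mat δ) (Complex.I • covec (m, n, A₀)) := by
    rw [covec_base, ← infAct_I_smul, ip_infAct_right]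
    ring
  have h2 : ip (covec (m, n, A₀)) (Complex.I • mat δ) =
      -ip (mat δ) (Complex.I • covec (m, n, A₀)) := by
    rw [ip_comm, ip_I_smul_left]
  have h3 : ip (infAct δ.1 δ.2.1 baseMat) (Complex.I • baseMat) = 2 * δ.2.1 2 := by
    rw [infAct_baseMat]
    simp [ip, A₀, Matrix.trace, Matrix.mul_apply, Fin.sum_univ_three]
    ring
  rw [dcovec, h, ip_add_left, h1, h2, h3, pair, ip_smul_right]
  simp
  ring

theorem pair_lieBr_grad_jm {γ₁ γ₂ γ₃ : ℝ} (hγ₁ : 0 < γ₁) (hγ₂ : 0 < γ₂) (hγ₃ : 0 < γ₃)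
    (g : SO3 × SO3) (m n : Fin 3 → ℝ) (η : LieAlg) :
    pair (rot g (0, 0, (-2 : ℝ) • Complex.I • baseMat)) η =
      pair (rot g (m, n, A₀)) (lieBr (grad (jm γ₁ γ₂ γ₃) (rot g (m, n, A₀))) η) := by
  rw [grad_jm_rot hγ₁ hγ₂ hγ₃, ← rotAlg_rotAlg_inv g η, lieBr_rotAlg, pair_rot, pair_rot]
  generalize rotAlg g⁻¹ η = η
  have h : mat (m, n, A₀) = baseMat := rfl
  have h' : mat (0, 0, (-2 : ℝ) • Complex.I • baseMat) = (-2 : ℝ) • Complex.I • baseMat := rfl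
  rw [pair, pair, h, h', lieBr]
  simp only [ip_sub_right, ip_infAct_right, infAct_baseMat, covec_base]
  -- The rotation of `n` about `e₃` cancels against the contribution of the matrix part of the
  -- gradient; only the phase change of `A` survives.
  simp [ip, A₀, Matrix.trace, Matrix.mul_apply, Fin.sum_univ_three, cross_apply,
    Matrix.vecHead, Matrix.vecTail]
  ring

theorem poisson_jm_hHam {γ₁ γ₂ γ₃ : ℝ} (hγ₁ : 0 < γ₁) (hγ₂ : 0 < γ₂) (hγ₃ : 0 < γ₃)
    (g : SO3 × SO3) (m n : Fin 3 → ℝ) :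
    poisson (jm γ₁ γ₂ γ₃) (hHam γ₁ γ₂ γ₃) (rot g (m, n, A₀)) = 0 := by
  rw [poisson_eq_fderiv (pair_lieBr_grad_jm hγ₁ hγ₂ hγ₃ g m n), fderiv_hHam hγ₁ hγ₂ hγ₃,
    dcovec_rot, covec_rot]
  have h : dcovec (m, n, A₀) (0, 0, (-2 : ℝ) • Complex.I • baseMat) =
      (-2 : ℝ) • Complex.I • covec (m, n, A₀) := by
    have h' : mat (0, 0, (-2 : ℝ) • Complex.I • baseMat) = (-2 : ℝ) • Complex.I • baseMat := rfl
    have h0 : ∀ A, infAct 0 0 A = 0 := fun A => by simpa using infAct_smul 0 0 0 A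
    rw [dcovec, h', infAct_smul_right, infAct_I_smul, covec_base]
    simp only [h0, zero_add]
  rw [h, act_smul, act_I_smul, ip_smul_right, Gam_inv hγ₁ hγ₂ hγ₃]
  generalize act g (covec (m, n, A₀)) = α
  generalize hd : (![γ₁⁻¹, γ₁⁻¹, (γ₁ + γ₂ + γ₃)⁻¹] : Fin 3 → ℝ) = d
  -- Multiplication by `i` is skew and commutes with the symmetric weight, so the form vanishes on
  -- `α` and `iα`.
  have h1 := ip_I_smul_left α (α * cplx (Matrix.diagonal d))
  have h2 := ip_mul_cplx_diagonal d α (Complex.I • α)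
  rw [Matrix.smul_mul] at h2
  rw [ip_comm] at h1
  linarith

theorem fderiv_J3orb_eq (p δ : LieDual) :
    fderiv ℝ J3orb p δ = 0 ⬝ᵥ δ.1 + ((-1 : ℝ) • Pi.single 2 1) ⬝ᵥ δ.2.1 := by
  rw [fderiv_J3orb]
  simp

theorem fderiv_J3spin_eq (p δ : LieDual) :
    fderiv ℝ J3spin p δ = Pi.single 2 1 ⬝ᵥ δ.1 + ((0 : ℝ) • Pi.single 2 1) ⬝ᵥ δ.2.1 := by
  rw [fderiv_J3spin]
  simp

/-- The zero second axis is written as a multiple of `e₃` to match `fderiv_hHam_rotField`. -/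
theorem fderiv_normSqJspin_eq (p δ : LieDual) :
    fderiv ℝ normSqJspin p δ = ((2 : ℝ) • p.1) ⬝ᵥ δ.1 + ((0 : ℝ) • Pi.single 2 1) ⬝ᵥ δ.2.1 := by
  rw [fderiv_normSqJspin]
  simp

theorem poisson_eq_zero {γ₁ γ₂ γ₃ : ℝ} (hγ₁ : 0 < γ₁) (hγ₂ : 0 < γ₂) (hγ₃ : 0 < γ₃)
    (g : SO3 × SO3) (m n : Fin 3 → ℝ) (i j : Fin 5) :
    poisson ((![hHam γ₁ γ₂ γ₃, jm γ₁ γ₂ γ₃, J3orb, J3spin, normSqJspin] :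
        Fin 5 → LieDual → ℝ) i)
      ((![hHam γ₁ γ₂ γ₃, jm γ₁ γ₂ γ₃, J3orb, J3spin, normSqJspin] :
        Fin 5 → LieDual → ℝ) j) (rot g (m, n, A₀)) = 0 := by
  set p := rot g (m, n, A₀) with hp
  set F : Fin 5 → LieDual → ℝ := ![hHam γ₁ γ₂ γ₃, jm γ₁ γ₂ γ₃, J3orb, J3spin, normSqJspin] with hF
  have h10 : poisson (F 1) (F 0) p = 0 := poisson_jm_hHam hγ₁ hγ₂ hγ₃ g m n
  have h20 : poisson (F 2) (F 0) p = 0 :=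
    (poisson_eq_fderiv_rotField (fderiv_J3orb_eq p)).trans
      (fderiv_hHam_rotField hγ₁ hγ₂ hγ₃ _ _ _)
  have h30 : poisson (F 3) (F 0) p = 0 :=
    (poisson_eq_fderiv_rotField (fderiv_J3spin_eq p)).trans
      (fderiv_hHam_rotField hγ₁ hγ₂ hγ₃ _ _ _)
  have h40 : poisson (F 4) (F 0) p = 0 :=
    (poisson_eq_fderiv_rotField (fderiv_normSqJspin_eq p)).trans
      (fderiv_hHam_rotField hγ₁ hγ₂ hγ₃ _ _ _)
  have h21 : poisson (F 2) (F 1) p = 0 :=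
    (poisson_eq_fderiv_rotField (fderiv_J3orb_eq p)).trans
      (fderiv_jm_rotField hγ₁ hγ₂ hγ₃ _ _ _)
  have h31 : poisson (F 3) (F 1) p = 0 :=
    (poisson_eq_fderiv_rotField (fderiv_J3spin_eq p)).trans
      (fderiv_jm_rotField hγ₁ hγ₂ hγ₃ _ _ _)
  have h41 : poisson (F 4) (F 1) p = 0 :=
    (poisson_eq_fderiv_rotField (fderiv_normSqJspin_eq p)).trans
      (fderiv_jm_rotField hγ₁ hγ₂ hγ₃ _ _ _)
  have h32 : poisson (F 3) (F 2) p = 0 :=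
    (poisson_eq_fderiv_rotField (fderiv_J3spin_eq p)).trans
      ((fderiv_J3orb p _).trans (by simp [rotField]))
  have h42 : poisson (F 4) (F 2) p = 0 :=
    (poisson_eq_fderiv_rotField (fderiv_normSqJspin_eq p)).trans
      ((fderiv_J3orb p _).trans (by simp [rotField]))
  have h43 : poisson (F 4) (F 3) p = 0 :=
    (poisson_eq_fderiv_rotField (fderiv_normSqJspin_eq p)).trans
      ((fderiv_J3spin p _).trans (by simp [rotField]))
  have key : ∀ i j : Fin 5, j < i → poisson (F i) (F j) p = 0 := by
    intro i j hij
    fin_cases i <;> fin_cases j <;> first | assumption | simp at hij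
  rcases lt_trichotomy i j with h | rfl | h
  · rw [poisson_antisymm, key j i h, neg_zero]
  · exact poisson_self _ _
  · exact key i j h


/-! ### Independence of the differentials -/

theorem mem_tangent_rot_of_snd (g : SO3 × SO3) (m n k : Fin 3 → ℝ) :
    ((0, k, 0) : LieDual) ∈ tangent (rot g (m, n, A₀)) := by
  have h : rot g (0, ((g.2⁻¹ : SO3) : Matrix (Fin 3) (Fin 3) ℝ) *ᵥ k, 0) = (0, k, 0) := by
    refine Prod.ext (Matrix.mulVec_zero (g.1 : Matrix (Fin 3) (Fin 3) ℝ))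
      (Prod.ext (SO3_mulVec_inv_mulVec _ _) ?_)
    change act g 0 = 0
    simp [act]
  rw [← h]
  apply rot_mem_tangent_rot
  rw [← baseTangent_range]
  refine ⟨(((g.2⁻¹ : SO3) : Matrix (Fin 3) (Fin 3) ℝ) *ᵥ k, 0, 0, 0), ?_⟩
  refine Prod.ext ?_ (Prod.ext rfl ?_)
  · simp [baseTangent]
  · simp [baseTangent, infAct_baseMat]
    ext i j
    fin_cases i <;> fin_cases j <;> rfl

theorem mem_tangent_rot_of_fst (g : SO3 × SO3) (m n k : Fin 3 → ℝ)
    (hk : k ⬝ᵥ ((g.1 : Matrix (Fin 3) (Fin 3) ℝ) *ᵥ Pi.single 2 1) = 0) :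
    ((k, 0, 0) : LieDual) ∈ tangent (rot g (m, n, A₀)) := by
  have h : rot g (((g.1⁻¹ : SO3) : Matrix (Fin 3) (Fin 3) ℝ) *ᵥ k, 0, 0) = (k, 0, 0) := by
    refine Prod.ext (SO3_mulVec_inv_mulVec _ _)
      (Prod.ext (Matrix.mulVec_zero (g.2 : Matrix (Fin 3) (Fin 3) ℝ)) ?_)
    change act g 0 = 0
    simp [act]
  rw [← SO3_mulVec_inv_mulVec g.1 k, SO3_mulVec_dotProduct] at hk
  rw [← h]
  apply rot_mem_tangent_rot
  rw [← baseTangent_range]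
  generalize ((g.1⁻¹ : SO3) : Matrix (Fin 3) (Fin 3) ℝ) *ᵥ k = k' at hk
  refine ⟨(0, 0, ![k' 0, k' 1], 0), ?_⟩
  refine Prod.ext ?_ (Prod.ext rfl ?_)
  · simp at hk
    ext i
    fin_cases i <;> simp [baseTangent, hk]
  · simp [baseTangent, infAct_baseMat]
    ext i j
    fin_cases i <;> fin_cases j <;> rfl

theorem act_baseMat (g : SO3 × SO3) :
    act g baseMat = Matrix.of fun i j => ((g.1 : Matrix (Fin 3) (Fin 3) ℝ) i 2 : ℂ) *
      (((g.2 : Matrix (Fin 3) (Fin 3) ℝ) j 0 : ℂ) +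
        ((g.2 : Matrix (Fin 3) (Fin 3) ℝ) j 1 : ℂ) * Complex.I) := by
  ext i j
  rw [act, SO3_coe_inv]
  simp [cplx, Matrix.mul_apply, Fin.sum_univ_three, A₀]
  ring

theorem mulVec_single_two (P : SO3) :
    (P : Matrix (Fin 3) (Fin 3) ℝ) *ᵥ Pi.single 2 1 =
      fun i => (P : Matrix (Fin 3) (Fin 3) ℝ) i 2 := by
  ext i
  simp

theorem SO3_row_dot (P : SO3) (i j : Fin 3) :
    (P : Matrix (Fin 3) (Fin 3) ℝ) i 0 * (P : Matrix (Fin 3) (Fin 3) ℝ) j 0 +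
      (P : Matrix (Fin 3) (Fin 3) ℝ) i 1 * (P : Matrix (Fin 3) (Fin 3) ℝ) j 1 +
      (P : Matrix (Fin 3) (Fin 3) ℝ) i 2 * (P : Matrix (Fin 3) (Fin 3) ℝ) j 2 =
      (1 : Matrix (Fin 3) (Fin 3) ℝ) i j := by
  rw [← SO3_mul_transpose P]
  simp [Matrix.mul_apply, Fin.sum_univ_three]

theorem SO3_col_dot (P : SO3) (i j : Fin 3) :
    (P : Matrix (Fin 3) (Fin 3) ℝ) 0 i * (P : Matrix (Fin 3) (Fin 3) ℝ) 0 j +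
      (P : Matrix (Fin 3) (Fin 3) ℝ) 1 i * (P : Matrix (Fin 3) (Fin 3) ℝ) 1 j +
      (P : Matrix (Fin 3) (Fin 3) ℝ) 2 i * (P : Matrix (Fin 3) (Fin 3) ℝ) 2 j =
      (1 : Matrix (Fin 3) (Fin 3) ℝ) i j := by
  rw [← SO3_transpose_mul P]
  simp [Matrix.mul_apply, Fin.sum_univ_three]

/-- On the orbit `A` has rank one, `A = a zᵀ`, and the two factors rotate separately. -/
theorem infAct_dyad (a v w : Fin 3 → ℝ) (z : Fin 3 → ℂ) :
    infAct v w (Matrix.of fun i j => (a i : ℂ) * z j) =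
      Matrix.of fun i j => ((v ⨯₃ a) i : ℂ) * z j + (a i : ℂ) * (z ⨯₃ fun k => (w k : ℂ)) j := by
  ext i j
  fin_cases i <;> fin_cases j <;>
    simp [infAct, hat, cplx, Matrix.mul_apply, Fin.sum_univ_three, cross_apply] <;> ring

theorem ip_dyad_add (a b : Fin 3 → ℝ) (z y x : Fin 3 → ℂ) (d : Fin 3 → ℝ) (hab : a ⬝ᵥ b = 0)
    (ha : a ⬝ᵥ a = 1) :
    ip ((Matrix.of fun i j => (b i : ℂ) * z j + (a i : ℂ) * y j) * cplx (Matrix.diagonal d))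
      (Matrix.of fun i j => (a i : ℂ) * x j) =
      d 0 * (star (y 0) * x 0).re + d 1 * (star (y 1) * x 1).re + d 2 * (star (y 2) * x 2).re := by
  simp [dotProduct, Fin.sum_univ_three] at ha hab
  simp [ip, cplx, Matrix.trace, Matrix.mul_apply, Fin.sum_univ_three, Matrix.diagonal]
  linear_combination
    (d 0 * ((z 0).re * (x 0).re + (z 0).im * (x 0).im) +
      d 1 * ((z 1).re * (x 1).re + (z 1).im * (x 1).im) +
      d 2 * ((z 2).re * (x 2).re + (z 2).im * (x 2).im)) * hab +
    (d 0 * ((y 0).re * (x 0).re + (y 0).im * (x 0).im) +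
      d 1 * ((y 1).re * (x 1).re + (y 1).im * (x 1).im) +
      d 2 * ((y 2).re * (x 2).re + (y 2).im * (x 2).im)) * ha

/-- The `M` term drops out since `M × a ⊥ a`. The rest depends on `u`, `w` only through `u uᵀ + w wᵀ
= 1 - l lᵀ`, of which one row suffices, and through their orthogonality to `l`. -/
theorem ip_infAct_dyad_cross {a u w l : Fin 3 → ℝ} (M N : Fin 3 → ℝ) (k₁ k₃ : ℝ)
    (ha : a ⬝ᵥ a = 1) (hu : u ⬝ᵥ l = 0) (hw : w ⬝ᵥ l = 0)
    (h : ∀ j, u 2 * u j + w 2 * w j + l 2 * l j = (1 : Matrix (Fin 3) (Fin 3) ℝ) 2 j) :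
    ip (infAct M N (Matrix.of fun i j => (a i : ℂ) * ((u j : ℂ) + (w j : ℂ) * Complex.I)) *
        cplx (Matrix.diagonal ![k₁, k₁, k₃]))
      (infAct 0 ![-l 1, l 0, 0]
        (Matrix.of fun i j => (a i : ℂ) * ((u j : ℂ) + (w j : ℂ) * Complex.I))) =
      (N 1 * l 0 - N 0 * l 1) * (k₁ * (1 - l 2 ^ 2) + k₃ * l 2 ^ 2) := by
  have h2 : ∀ i, (((0 : Fin 3 → ℝ) ⨯₃ a) i : ℂ) = 0 := fun i => by simp
  rw [infAct_dyad _ _ _ fun j => (u j : ℂ) + (w j : ℂ) * Complex.I,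
    infAct_dyad _ _ _ fun j => (u j : ℂ) + (w j : ℂ) * Complex.I]
  simp only [h2, zero_mul, zero_add]
  rw [ip_dyad_add _ _ _ _ _ _ (dot_cross_self _ _) ha]
  have r0 := h 0
  have r1 := h 1
  have r2 := h 2
  simp [dotProduct, Fin.sum_univ_three] at hu hw r0 r1 r2
  simp [cross_apply]
  linear_combination (k₁ * l 1 * N 2 - k₃ * l 2 * N 1) * r0 +
    (k₃ * l 2 * N 0 - k₁ * l 0 * N 2) * r1 + (k₁ * l 0 * N 1 - k₁ * l 1 * N 0) * r2 +
    k₃ * (u 0 * N 1 - u 1 * N 0) * hu + k₃ * (w 0 * N 1 - w 1 * N 0) * hw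

theorem fderiv_hHam_cross {γ₁ γ₂ γ₃ : ℝ} (hγ₁ : 0 < γ₁) (hγ₂ : 0 < γ₂) (hγ₃ : 0 < γ₃)
    (g : SO3 × SO3) (m n : Fin 3 → ℝ) {l N : Fin 3 → ℝ}
    (hl : l = (g.2 : Matrix (Fin 3) (Fin 3) ℝ) *ᵥ Pi.single 2 1)
    (hN : N = (rot g (m, n, A₀)).2.1) :
    fderiv ℝ (hHam γ₁ γ₂ γ₃) (rot g (m, n, A₀)) (0, ![-l 1, l 0, 0], 0) =
      1 / 2 * ((N 1 * l 0 - N 0 * l 1) *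
        (γ₁⁻¹ * (1 - l 2 ^ 2) + (γ₁ + γ₂ + γ₃)⁻¹ * l 2 ^ 2)) := by
  rw [fderiv_hHam hγ₁ hγ₂ hγ₃, Gam_inv hγ₁ hγ₂ hγ₃, covec, dcovec, mat_rot, ← hN]
  generalize (rot g (m, n, A₀)).1 = M
  have h0 : infAct M N (mat (0, ![-l 1, l 0, 0], 0)) = 0 := by
    have : mat (0, ![-l 1, l 0, 0], 0) = 0 := rfl
    rw [this]
    simp [infAct]
  have h1 : mat (m, n, A₀) = baseMat := rfl
  rw [h0, add_zero, h1, act_baseMat]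
  rw [mulVec_single_two] at hl
  subst hl
  have ha := SO3_col_dot g.1 2 2
  have hu := SO3_col_dot g.2 0 2
  have hw := SO3_col_dot g.2 1 2
  congr 1
  refine ip_infAct_dyad_cross (a := fun i => (g.1 : Matrix (Fin 3) (Fin 3) ℝ) i 2)
    (u := fun i => (g.2 : Matrix (Fin 3) (Fin 3) ℝ) i 0)
    (w := fun i => (g.2 : Matrix (Fin 3) (Fin 3) ℝ) i 1)
    (l := fun i => (g.2 : Matrix (Fin 3) (Fin 3) ℝ) i 2) M N γ₁⁻¹ (γ₁ + γ₂ + γ₃)⁻¹ ?_ ?_ ?_ ?_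
  · simpa [dotProduct, Fin.sum_univ_three] using ha
  · simpa [dotProduct, Fin.sum_univ_three] using hu
  · simpa [dotProduct, Fin.sum_univ_three] using hw
  · exact fun j => SO3_row_dot g.2 2 j

theorem fderiv_jm_snd {γ₁ γ₂ γ₃ : ℝ} (hγ₁ : 0 < γ₁) (hγ₂ : 0 < γ₂) (hγ₃ : 0 < γ₃)
    (g : SO3 × SO3) (m n k : Fin 3 → ℝ) :
    fderiv ℝ (jm γ₁ γ₂ γ₃) (rot g (m, n, A₀)) (0, k, 0) =
      2 * (k ⬝ᵥ ((g.2 : Matrix (Fin 3) (Fin 3) ℝ) *ᵥ Pi.single 2 1)) := by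
  rw [← pair_grad, grad_jm_rot hγ₁ hγ₂ hγ₃]
  have h : mat (0, k, 0) = 0 := rfl
  simp only [pair, rotAlg, h, Matrix.mulVec_smul, dotProduct_smul]
  simp [ip]

theorem linearIndependent_of_ne_zero {γ₁ γ₂ γ₃ : ℝ} (hγ₁ : 0 < γ₁) (hγ₂ : 0 < γ₂) (hγ₃ : 0 < γ₃)
    (g : SO3 × SO3) (m n : Fin 3 → ℝ) {p : LieDual} (hp : p = rot g (m, n, A₀))
    {a l : Fin 3 → ℝ}
    (ha : a = (g.1 : Matrix (Fin 3) (Fin 3) ℝ) *ᵥ Pi.single 2 1)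
    (hl : l = (g.2 : Matrix (Fin 3) (Fin 3) ℝ) *ᵥ Pi.single 2 1)
    (h1 : p.1 0 * a 1 - p.1 1 * a 0 ≠ 0) (h2 : p.2.1 1 * l 0 - p.2.1 0 * l 1 ≠ 0) :
    LinearIndependent ℝ fun i : Fin 5 =>
      ((fderiv ℝ ((![hHam γ₁ γ₂ γ₃, jm γ₁ γ₂ γ₃, J3orb, J3spin, normSqJspin] :
        Fin 5 → LieDual → ℝ) i) p : LieDual →L[ℝ] ℝ) : LieDual →ₗ[ℝ] ℝ).domRestrict
          (tangent p) := by
  have hll : l 0 ^ 2 + l 1 ^ 2 + l 2 ^ 2 = 1 := by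
    have h := SO3_col_dot g.2 2 2
    rw [mulVec_single_two] at hl
    simp only [hl, Matrix.one_apply_eq] at h ⊢
    linarith
  -- The condition `h2` excludes `l = ±e₃`.
  have hl01 : 0 < l 0 ^ 2 + l 1 ^ 2 := by
    by_contra hcon
    have e0 : l 0 = 0 := by nlinarith [sq_nonneg (l 0), sq_nonneg (l 1)]
    have e1 : l 1 = 0 := by nlinarith [sq_nonneg (l 0), sq_nonneg (l 1)]
    exact h2 (by rw [e0, e1]; ring)
  have hpos : 0 < γ₁⁻¹ * (1 - l 2 ^ 2) + (γ₁ + γ₂ + γ₃)⁻¹ * l 2 ^ 2 := by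
    have e : 0 < 1 - l 2 ^ 2 := by linarith
    positivity
  rw [Fintype.linearIndependent_iff]
  intro c hc
  have key : ∀ δ ∈ tangent p, c 0 * fderiv ℝ (hHam γ₁ γ₂ γ₃) p δ +
      c 1 * fderiv ℝ (jm γ₁ γ₂ γ₃) p δ + c 2 * -(δ.2.1 2) + c 3 * δ.1 2 +
      c 4 * (2 * (p.1 ⬝ᵥ δ.1)) = 0 := by
    intro δ hδ
    have h := LinearMap.congr_fun hc ⟨δ, hδ⟩
    rw [← fderiv_J3orb p δ, ← fderiv_J3spin p δ, ← fderiv_normSqJspin p δ]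
    simpa [Fin.sum_univ_five] using h
  have hsnd : ∀ k : Fin 3 → ℝ, ((0, k, 0) : LieDual) ∈ tangent p := fun k => by
    rw [hp]
    exact mem_tangent_rot_of_snd g m n k
  have hfst : ∀ k : Fin 3 → ℝ, k ⬝ᵥ a = 0 → ((k, 0, 0) : LieDual) ∈ tangent p := fun k hk => by
    rw [hp]
    exact mem_tangent_rot_of_fst g m n k (by rwa [← ha])
  have hjm : ∀ k, fderiv ℝ (jm γ₁ γ₂ γ₃) p (0, k, 0) = 2 * (k ⬝ᵥ l) := fun k => by
    rw [hp, hl]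
    exact fderiv_jm_snd hγ₁ hγ₂ hγ₃ g m n k
  -- The vector `e₃ × l` is orthogonal to `e₃` and `l`, hence invisible to the differentials of
  -- `J3orb` and `jm`.
  have c0 : c 0 = 0 := by
    have h := key _ (hsnd ![-l 1, l 0, 0])
    have hh : fderiv ℝ (hHam γ₁ γ₂ γ₃) p (0, ![-l 1, l 0, 0], 0) =
        1 / 2 * ((p.2.1 1 * l 0 - p.2.1 0 * l 1) *
          (γ₁⁻¹ * (1 - l 2 ^ 2) + (γ₁ + γ₂ + γ₃)⁻¹ * l 2 ^ 2)) := by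
      rw [hp]
      exact fderiv_hHam_cross hγ₁ hγ₂ hγ₃ g m n hl rfl
    have hd : (![-l 1, l 0, 0] : Fin 3 → ℝ) ⬝ᵥ l = 0 := by
      simp [dotProduct, Fin.sum_univ_three]
      ring
    rw [hh, hjm, hd] at h
    have e : c 0 * (1 / 2 * ((p.2.1 1 * l 0 - p.2.1 0 * l 1) *
        (γ₁⁻¹ * (1 - l 2 ^ 2) + (γ₁ + γ₂ + γ₃)⁻¹ * l 2 ^ 2))) = 0 := by
      simpa using h
    exact (mul_eq_zero.1 e).resolve_right
      (mul_ne_zero (by norm_num) (mul_ne_zero h2 hpos.ne'))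
  -- The horizontal part of `l` is invisible to `J3orb`, but not to `jm`.
  have c1 : c 1 = 0 := by
    have h := key _ (hsnd ![l 0, l 1, 0])
    have hd : (![l 0, l 1, 0] : Fin 3 → ℝ) ⬝ᵥ l = l 0 ^ 2 + l 1 ^ 2 := by
      simp [dotProduct, Fin.sum_univ_three]
      ring
    rw [c0, hjm, hd] at h
    have e : c 1 * (2 * (l 0 ^ 2 + l 1 ^ 2)) = 0 := by simpa using h
    exact (mul_eq_zero.1 e).resolve_right (by positivity)
  have c2 : c 2 = 0 := by
    have h := key _ (hsnd (Pi.single 2 1))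
    rw [c0, c1] at h
    simpa using h
  -- Moving `M` along `M × a` preserves its norm to first order.
  have c3 : c 3 = 0 := by
    have hd : (p.1 ⨯₃ a) ⬝ᵥ a = 0 := by rw [dotProduct_comm, dot_cross_self]
    have h := key _ (hfst (p.1 ⨯₃ a) hd)
    rw [c0, c1, c2, dot_self_cross] at h
    have e : c 3 * (p.1 0 * a 1 - p.1 1 * a 0) = 0 := by simpa [cross_apply] using h
    exact (mul_eq_zero.1 e).resolve_right h1
  have c4 : c 4 = 0 := by
    have hd : (![a 1, -a 0, 0] : Fin 3 → ℝ) ⬝ᵥ a = 0 := by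
      simp [dotProduct, Fin.sum_univ_three]
      ring
    have h := key _ (hfst _ hd)
    rw [c0, c1, c2, c3] at h
    have e : c 4 * (2 * (p.1 0 * a 1 - p.1 1 * a 0)) = 0 := by
      have e' : p.1 ⬝ᵥ ![a 1, -a 0, 0] = p.1 0 * a 1 - p.1 1 * a 0 := by
        simp [dotProduct, Fin.sum_univ_three]
        ring
      simpa [← e'] using h
    exact (mul_eq_zero.1 e).resolve_right (mul_ne_zero two_ne_zero h1)
  intro i
  fin_cases i <;> assumption


/-! ### Spherical frames and Euler angles -/

/-- The radial vector of the spherical frame. -/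
noncomputable def frameR (θ φ : ℝ) : Fin 3 → ℝ :=
  ![Real.sin θ * Real.cos φ, Real.sin θ * Real.sin φ, Real.cos θ]

/-- The polar vector of the spherical frame. -/
noncomputable def frameT (θ φ : ℝ) : Fin 3 → ℝ :=
  ![Real.cos θ * Real.cos φ, Real.cos θ * Real.sin φ, -Real.sin θ]

/-- The azimuthal vector of the spherical frame. -/
noncomputable def frameP (φ : ℝ) : Fin 3 → ℝ := ![-Real.sin φ, Real.cos φ, 0]

/-- The origin is included, with `r = 0` and the default value of `arg`, so the poles of the sphere
need no separate treatment. -/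
theorem exists_polar (x y : ℝ) :
    ∃ r φ : ℝ, 0 ≤ r ∧ x = r * Real.cos φ ∧ y = r * Real.sin φ ∧ r ^ 2 = x ^ 2 + y ^ 2 := by
  refine ⟨‖(⟨x, y⟩ : ℂ)‖, Complex.arg ⟨x, y⟩, norm_nonneg _, (Complex.norm_mul_cos_arg ⟨x, y⟩).symm,
    (Complex.norm_mul_sin_arg ⟨x, y⟩).symm, ?_⟩
  rw [Complex.sq_norm, Complex.normSq_mk]
  ring

theorem exists_angle {x y : ℝ} (h : x ^ 2 + y ^ 2 = 1) :
    ∃ φ : ℝ, x = Real.cos φ ∧ y = Real.sin φ := by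
  obtain ⟨r, φ, hr0, hx, hy, hr⟩ := exists_polar x y
  have h1 : r = 1 := (pow_eq_one_iff_of_nonneg hr0 two_ne_zero).1 (hr.trans h)
  exact ⟨φ, by rw [hx, h1, one_mul], by rw [hy, h1, one_mul]⟩

theorem exists_frameR {l : Fin 3 → ℝ} (h : l ⬝ᵥ l = 1) : ∃ θ φ : ℝ, l = frameR θ φ := by
  obtain ⟨r, φ, -, hx, hy, hr⟩ := exists_polar (l 0) (l 1)
  obtain ⟨θ, hz, hr'⟩ := exists_angle (x := l 2) (y := r) (by
    simp [dotProduct, Fin.sum_univ_three] at h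
    linarith)
  refine ⟨θ, φ, ?_⟩
  ext i
  fin_cases i <;> simp [frameR, hx, hy, hz, hr']

theorem frame_expansion (θ φ : ℝ) (x : Fin 3 → ℝ) :
    x = (x ⬝ᵥ frameT θ φ) • frameT θ φ + (x ⬝ᵥ frameP φ) • frameP φ +
      (x ⬝ᵥ frameR θ φ) • frameR θ φ := by
  have h1 := Real.sin_sq_add_cos_sq θ
  have h2 := Real.sin_sq_add_cos_sq φ
  ext i
  fin_cases i <;> simp [frameR, frameT, frameP, dotProduct, Fin.sum_univ_three]
  · linear_combination (-x 0) * h2 - (x 0 * Real.cos φ ^ 2 +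
      x 1 * Real.sin φ * Real.cos φ) * h1
  · linear_combination (-x 1) * h2 - (x 1 * Real.sin φ ^ 2 +
      x 0 * Real.sin φ * Real.cos φ) * h1
  · linear_combination (-x 2) * h1

/-- The angle `ψ` is the third Euler angle: it places `u` in the plane orthogonal to the radial
vector, and orientation then fixes `w`. -/
theorem exists_frame_of_orthonormal {u w : Fin 3 → ℝ} {θ φ : ℝ} (hu : u ⬝ᵥ u = 1)
    (hul : u ⬝ᵥ frameR θ φ = 0) (hw : w = frameR θ φ ⨯₃ u) :
    ∃ ψ : ℝ, u = Real.cos ψ • frameT θ φ + Real.sin ψ • frameP φ ∧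
      w = -Real.sin ψ • frameT θ φ + Real.cos ψ • frameP φ := by
  have hexp := frame_expansion θ φ u
  rw [hul, zero_smul, add_zero] at hexp
  generalize u ⬝ᵥ frameT θ φ = x at hexp
  generalize u ⬝ᵥ frameP φ = y at hexp
  have h1 := Real.sin_sq_add_cos_sq θ
  have h2 := Real.sin_sq_add_cos_sq φ
  have hxy : x ^ 2 + y ^ 2 = 1 := by
    rw [← hu, hexp]
    simp [frameT, frameP, dotProduct, Fin.sum_univ_three]
    linear_combination (-x ^ 2 * Real.cos θ ^ 2 - y ^ 2) * h2 - x ^ 2 * h1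
  obtain ⟨ψ, rfl, rfl⟩ := exists_angle hxy
  refine ⟨ψ, hexp, ?_⟩
  rw [hw, hexp]
  ext i
  fin_cases i <;> simp [frameR, frameT, frameP, cross_apply]
  · linear_combination (-Real.cos ψ * Real.sin φ) * h1
  · linear_combination (Real.cos ψ * Real.cos φ) * h1
  · linear_combination (Real.sin ψ * Real.sin θ) * h2

/-- A smooth parametrization of a set containing the coadjoint orbits through the points
`(m₀, n₀, A₀)` with `m₀ 2 = c`. -/
noncomputable def orbitParam (c : ℝ) (x : Fin 10 → ℝ) : LieDual :=
  (x 2 • frameT (x 0) (x 1) + x 3 • frameP (x 1) + c • frameR (x 0) (x 1),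
   x 7 • frameT (x 4) (x 5) + x 8 • frameP (x 5) + x 9 • frameR (x 4) (x 5),
   fun i j => (frameR (x 0) (x 1) i : ℂ) *
    (((Real.cos (x 6) • frameT (x 4) (x 5) + Real.sin (x 6) • frameP (x 5)) j : ℝ) +
      ((-Real.sin (x 6) • frameT (x 4) (x 5) + Real.cos (x 6) • frameP (x 5)) j : ℝ) *
        Complex.I))

theorem contDiff_orbitParam (c : ℝ) : ContDiff ℝ 1 (orbitParam c) := by
  have hR : ∀ i j : Fin 10, ContDiff ℝ 1 fun x : Fin 10 → ℝ => frameR (x i) (x j) := by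
    intro i j
    rw [contDiff_pi]
    intro k
    fin_cases k <;> simp [frameR] <;> fun_prop
  have hT : ∀ i j : Fin 10, ContDiff ℝ 1 fun x : Fin 10 → ℝ => frameT (x i) (x j) := by
    intro i j
    rw [contDiff_pi]
    intro k
    fin_cases k <;> simp [frameT] <;> fun_prop
  have hP : ∀ j : Fin 10, ContDiff ℝ 1 fun x : Fin 10 → ℝ => frameP (x j) := by
    intro j
    rw [contDiff_pi]
    intro k
    fin_cases k <;> simp [frameP] <;> fun_prop
  have hc : ∀ {f : (Fin 10 → ℝ) → ℝ}, ContDiff ℝ 1 f → ContDiff ℝ 1 fun p => (f p : ℂ) :=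
    fun hf => Complex.ofRealCLM.contDiff.comp hf
  have hx : ∀ i : Fin 10, ContDiff ℝ 1 fun x : Fin 10 → ℝ => x i := fun i => contDiff_apply ℝ ℝ i
  refine ContDiff.prodMk ?_ (ContDiff.prodMk ?_ ?_)
  · exact (((hx 2).smul (hT 0 1)).add ((hx 3).smul (hP 1))).add ((hR 0 1).const_smul c)
  · exact (((hx 7).smul (hT 4 5)).add ((hx 8).smul (hP 5))).add ((hx 9).smul (hR 4 5))
  · rw [contDiff_pi]
    intro i
    rw [contDiff_pi]
    intro j
    refine (hc (contDiff_pi.1 (hR 0 1) i)).mul ((hc (contDiff_pi.1 ?_ j)).add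
      ((hc (contDiff_pi.1 ?_ j)).mul contDiff_const))
    · exact ((hx 6).cos.smul (hT 4 5)).add ((hx 6).sin.smul (hP 5))
    · exact ((hx 6).sin.neg.smul (hT 4 5)).add ((hx 6).cos.smul (hP 5))

theorem exists_orbitParam (g : SO3 × SO3) (m n : Fin 3 → ℝ) :
    ∃ x : Fin 10 → ℝ, rot g (m, n, A₀) = orbitParam (m 2) x ∧
      (g.1 : Matrix (Fin 3) (Fin 3) ℝ) *ᵥ Pi.single 2 1 = frameR (x 0) (x 1) ∧
      (g.2 : Matrix (Fin 3) (Fin 3) ℝ) *ᵥ Pi.single 2 1 = frameR (x 4) (x 5) := by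
  have hunit : ∀ P : SO3, ((P : Matrix (Fin 3) (Fin 3) ℝ) *ᵥ Pi.single 2 1) ⬝ᵥ
      ((P : Matrix (Fin 3) (Fin 3) ℝ) *ᵥ Pi.single 2 1) = 1 := fun P => by
    rw [SO3_mulVec_dotProduct]
    simp
  obtain ⟨θ, φ, ha⟩ := exists_frameR (hunit g.1)
  obtain ⟨θ', φ', hl⟩ := exists_frameR (hunit g.2)
  obtain ⟨ψ, hu, hw⟩ := exists_frame_of_orthonormal (θ := θ') (φ := φ')
    (u := (g.2 : Matrix (Fin 3) (Fin 3) ℝ) *ᵥ Pi.single 0 1)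
    (w := (g.2 : Matrix (Fin 3) (Fin 3) ℝ) *ᵥ Pi.single 1 1)
    (by rw [SO3_mulVec_dotProduct]; simp)
    (by rw [← hl, SO3_mulVec_dotProduct]; simp)
    (by
      rw [← hl, ← SO3_mulVec_cross]
      congr 1
      ext i
      fin_cases i <;> simp [cross_apply])
  set M := (g.1 : Matrix (Fin 3) (Fin 3) ℝ) *ᵥ m with hM
  set N := (g.2 : Matrix (Fin 3) (Fin 3) ℝ) *ᵥ n with hN
  -- The radial component of `M` is constant on the orbit, which reduces the parameters from eleven
  -- to ten.
  have hMa : M ⬝ᵥ frameR θ φ = m 2 := by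
    rw [← ha, hM, SO3_mulVec_dotProduct]
    simp
  refine ⟨![θ, φ, M ⬝ᵥ frameT θ φ, M ⬝ᵥ frameP φ, θ', φ', ψ, N ⬝ᵥ frameT θ' φ', N ⬝ᵥ frameP φ',
    N ⬝ᵥ frameR θ' φ'], ?_, ha, hl⟩
  refine Prod.ext ?_ (Prod.ext ?_ ?_)
  · exact (frame_expansion θ φ M).trans (by rw [hMa]; rfl)
  · exact frame_expansion θ' φ' N
  · change act g baseMat = Matrix.of fun i j => (frameR θ φ i : ℂ) *
      (((Real.cos ψ • frameT θ' φ' + Real.sin ψ • frameP φ') j : ℝ) +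
        ((-Real.sin ψ • frameT θ' φ' + Real.cos ψ • frameP φ') j : ℝ) * Complex.I)
    rw [act_baseMat, ← hu, ← hw, ← ha]
    ext i j
    simp

/-! ### The set of dependence is null -/

/-- A `C¹` map does not raise Hausdorff dimension, so each slice has dimension at most nine. Taking
all ten coordinates and all multiples of `π` covers both the zeros of the sines and, with `k = 0`,
the coordinate hyperplanes. -/
theorem hausdorffMeasure_iUnion_slices_eq_zero {f : (Fin 10 → ℝ) → LieDual}
    (hf : ContDiff ℝ 1 f) :
    μH[10] (⋃ (i : Fin 10) (k : ℤ), f '' {x | x i = k * Real.pi}) = 0 := by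
  refine measure_iUnion_null fun i => measure_iUnion_null fun k => ?_
  let e : (Fin 9 → ℝ) → Fin 10 → ℝ := fun y => i.insertNth (k * Real.pi) y
  have he : ContDiff ℝ 1 e := by
    rw [contDiff_pi]
    intro j
    rcases Fin.eq_self_or_eq_succAbove i j with rfl | ⟨j, rfl⟩
    · simpa [e] using contDiff_const
    · simpa [e] using contDiff_apply ℝ ℝ j
  have hsub : f '' {x | x i = k * Real.pi} ⊆ Set.range (f ∘ e) := by
    rintro _ ⟨x, hx, rfl⟩
    refine ⟨i.removeNth x, congrArg f ?_⟩
    have hx' : x i = k * Real.pi := hx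
    change i.insertNth (k * Real.pi) (i.removeNth x) = x
    rw [← hx', Fin.insertNth_self_removeNth]
  refine measure_mono_null hsub ?_
  have hdim : dimH (Set.range (f ∘ e)) < ((10 : NNReal) : ENNReal) := by
    refine (ContDiff.dimH_range_le (hf.comp he)).trans_lt ?_
    rw [Module.finrank_fin_fun]
    norm_num
  exact_mod_cast hausdorffMeasure_of_dimH_lt hdim

end SuperfluidHe3

theorem theorem4p5 (γ₁ γ₂ γ₃ : ℝ) (hγ₁ : 0 < γ₁) (hγ₂ : 0 < γ₂) (hγ₃ : 0 < γ₃)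
    (m₀ n₀ : Fin 3 → ℝ) :
    SuperfluidHe3.IsCompletelyIntegrable (m₀, n₀, SuperfluidHe3.A₀)
      ![SuperfluidHe3.hHam γ₁ γ₂ γ₃, SuperfluidHe3.jm γ₁ γ₂ γ₃, SuperfluidHe3.J3orb,
        SuperfluidHe3.J3spin, SuperfluidHe3.normSqJspin] := by
  open SuperfluidHe3 in
  refine ⟨?_, ?_, ?_, ?_⟩
  · intro i
    fin_cases i
    · exact contDiff_hHam γ₁ γ₂ γ₃
    · exact contDiff_jm hγ₁ hγ₂ hγ₃
    · exact contDiff_J3orb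
    · exact contDiff_J3spin
    · exact contDiff_normSqJspin
  · intro p hp
    obtain ⟨g, m, n, -, rfl⟩ := exists_rot_of_mem_coadjointOrbit hp
    rw [finrank_tangent_rot, finrank_tangent_base]
  · intro i j p hp
    obtain ⟨g, m, n, -, rfl⟩ := exists_rot_of_mem_coadjointOrbit hp
    exact poisson_eq_zero hγ₁ hγ₂ hγ₃ g m n i j
  · have h10 : ((2 * 5 : ℕ) : ℝ) = 10 := by norm_num
    rw [h10]
    refine measure_mono_null ?_
      (hausdorffMeasure_iUnion_slices_eq_zero (contDiff_orbitParam (m₀ 2)))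
    rintro p ⟨hp, hdep⟩
    obtain ⟨g, m, n, hm, hpg⟩ := exists_rot_of_mem_coadjointOrbit hp
    obtain ⟨x, hx, ha, hl⟩ := exists_orbitParam g m n
    rw [hm] at hx
    have hpx : p = orbitParam (m₀ 2) x := hpg.trans hx
    have hmem : ∀ (i : Fin 10) (k : ℤ), x i = k * Real.pi →
        p ∈ ⋃ (i : Fin 10) (k : ℤ), orbitParam (m₀ 2) '' {x | x i = k * Real.pi} :=
      fun i k hik => Set.mem_iUnion.2 ⟨i, Set.mem_iUnion.2 ⟨k, x, hik, hpx.symm⟩⟩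
    have hsin : ∀ i : Fin 10, Real.sin (x i) = 0 →
        p ∈ ⋃ (i : Fin 10) (k : ℤ), orbitParam (m₀ 2) '' {x | x i = k * Real.pi} := by
      intro i hi
      obtain ⟨k, hk⟩ := Real.sin_eq_zero_iff.1 hi
      exact hmem i k hk.symm
    have hzero : ∀ i : Fin 10, x i = 0 →
        p ∈ ⋃ (i : Fin 10) (k : ℤ), orbitParam (m₀ 2) '' {x | x i = k * Real.pi} :=
      fun i hi => hmem i 0 (by simpa using hi)
    by_contra hnot
    refine hdep (linearIndependent_of_ne_zero hγ₁ hγ₂ hγ₃ g m n hpg ha.symm hl.symm ?_ ?_)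
    -- Only the azimuthal component of `M` survives: the radial part is parallel to `a`, and the
    -- polar part gives a horizontal cross product.
    · have e : p.1 0 * frameR (x 0) (x 1) 1 - p.1 1 * frameR (x 0) (x 1) 0 =
          -(x 3 * Real.sin (x 0)) := by
        rw [hpx]
        simp [orbitParam, frameR, frameT, frameP]
        linear_combination (-(x 3 * Real.sin (x 0))) * Real.sin_sq_add_cos_sq (x 1)
      rw [e]
      exact neg_ne_zero.2 (mul_ne_zero (fun h => hnot (hzero 3 h)) fun h => hnot (hsin 0 h))
    · have e : p.2.1 1 * frameR (x 4) (x 5) 0 - p.2.1 0 * frameR (x 4) (x 5) 1 =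
          x 8 * Real.sin (x 4) := by
        rw [hpx]
        simp [orbitParam, frameR, frameT, frameP]
        linear_combination (x 8 * Real.sin (x 4)) * Real.sin_sq_add_cos_sq (x 5)
      rw [e]
      exact mul_ne_zero (fun h => hnot (hzero 8 h)) fun h => hnot (hsin 4 h)
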